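/- Let $M$ be a smooth ($C^\infty$) paracompact Hausdorff manifold of finite dimension, $\pi:\mathcal TM\to M$ the bundle of its nonzero tangent vectors, and $\pi^{-1}(TM)$ the pullback of $TM$ to $\mathcal TM$; sections of $\pi^{-1}(TM)$ are called $\pi$-vector fields, and $\overline\eta(u)=u$ is the fundamental one. Let $\rho:T(\mathcal TM)\to\pi^{-1}(TM)$ be the map induced by $d\pi$, let $\gamma:\pi^{-1}(TM)\to T(\mathcal TM)$ be the vertical lift, and let $J=\gamma\circ\rho$; for a function $f$ put $d_Jf=df\circ J$. A Finsler structure on $M$ is a continuous function $L:TM\to\mathbb R$, smooth and positive on $\mathcal TM$, with $L(\lambda u)=\lambda L(u)$ for $\lambda>0$, such that, with $E=\frac12L^2$, the fibrewise Hessian $g$ of $E$ at every $u\in\mathcal TM$ is positive definite; $g$ is a metric on $\pi^{-1}(TM)$. The canonical spray $G$ of $L$ is the vector field on $\mathcal TM$ with $i_G\,dd_JE=-dE$, and the Barthel connection of $L$ is the vector $1$-form $\Gamma=[J,G]$, i.e. $\Gamma X=[JX,G]-J[X,G]$, with horizontal and vertical projectors $h=\frac12(I+\Gamma)$ and $v=\frac12(I-\Gamma)$.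 The Cartan connection $\nabla$ of $L$ is the unique linear connection on $\pi^{-1}(TM)$ which is regular (that is, $T_u(\mathcal TM)=\ker\rho_u\oplus\ker K_u$ for every $u$, where $K(X)=\nabla_X\overline\eta$; vectors in $\ker K$ are called horizontal) and metric ($\nabla g=0$), and whose torsion $\mathbf T(X,Y)=\nabla_X\rho Y-\nabla_Y\rho X-\rho[X,Y]$ vanishes on pairs of horizontal vectors and satisfies $g(\mathbf T(X,Y),\rho Z)=g(\mathbf T(X,Z),\rho Y)$ for $X$ vertical and $Y,Z$ horizontal. A smooth $\pi$-vector field $\overline\zeta$ is concurrent for $L$ if $\nabla_X\overline\zeta=-\rho X$ for all $X$. Theorem. Let $L$ and $\widetilde L$ be Finsler structures on $M$, let $\overline\zeta$ be a concurrent $\pi$-vector field for $L$, and suppose that $\widetilde L^2=L^2+B^2$ on $\mathcal TM$, where $B=g(\overline\zeta,\overline\eta)$. Put $p^2=g(\overline\zeta,\overline\zeta)$. Then the Barthel connections $\Gamma$ of $L$ and $\widetilde\Gamma$ of $\widetilde L$ satisfy, on $\mathcal TM$, $$\widetilde\Gamma=\Gamma+2\,\frac{d_JE}{1+p^2}\otimes\gamma\overline\zeta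 .$$ Equivalently, $\widetilde h=h-\mathcal L$ and $\widetilde v=v+\mathcal L$, where $\mathcal L=-\dfrac{d_JE}{1+p^2}\otimes\gamma\overline\zeta$. -/

import Mathlib

open Set Bundle VectorField
open scoped Manifold ContDiff Topology

noncomputable section

namespace Finsler

universe u v

variable {E : Type u} [NormedAddCommGroup E] [NormedSpace ℝ E]
  {M : Type v} [TopologicalSpace M] [ChartedSpace E M] [IsManifold 𝓘(ℝ, E) ∞ M]

/-! ### The tangent bundle, the double tangent bundle and the pullback bundle -/

variable (E M) in
/-- The total space `TM` of the tangent bundle of `M`. -/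
abbrev TM : Type (max u v) := TangentBundle 𝓘(ℝ, E) M

/-- The fibre `T_{π w} M` over `w` of the pullback bundle `π⁻¹(TM)`. -/
abbrev PiFib (w : TM E M) : Type u := TangentSpace 𝓘(ℝ, E) w.proj

/-- The tangent space `T_w (TM)` of the manifold `TM` at `w`. -/
abbrev TTan (w : TM E M) : Type u := TangentSpace (𝓘(ℝ, E).tangent) w

variable (E M) in
/-- The slit tangent bundle `𝒯M`: the open set of nonzero tangent vectors of `M`. Fields on `𝒯M`
are represented by fields on `TM` whose values on the zero section are irrelevant. -/
def slit : Set (TM E M) := {w | w.2 ≠ 0}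

variable (E M) in
/-- A (not necessarily smooth) vector field on `TM`. -/
abbrev VField : Type (max u v) := ∀ w : TM E M, TTan w

variable (E M) in
/-- A (not necessarily smooth) `π`-vector field, i.e. a section `w ↦ Y w ∈ T_{π w} M` of the
pullback `π⁻¹(TM)` of the tangent bundle by `π`. -/
abbrev PiField : Type (max u v) := ∀ w : TM E M, PiFib w

/-- A vector field on `TM`, seen as a map into the total space `TTM`. -/
def VField.toMap (X : VField E M) (w : TM E M) :
    TangentBundle (𝓘(ℝ, E).tangent) (TM E M) := ⟨w, X w⟩

/-- A `π`-vector field, seen as a map `TM → TM` over `M`. Since `π⁻¹(TM)` is the fibre product of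
`TM` with itself over `M`, its smoothness is the smoothness of this map. -/
def PiField.toMap (Y : PiField E M) (w : TM E M) : TM E M := ⟨w.proj, Y w⟩

/-- The vector field `X` is differentiable at `w`. -/
def VField.DiffAt (X : VField E M) (w : TM E M) : Prop :=
  MDifferentiableAt (𝓘(ℝ, E).tangent) (𝓘(ℝ, E).tangent.tangent) X.toMap w

/-- The `π`-vector field `Y` is differentiable at `w`. -/
def PiField.DiffAt (Y : PiField E M) (w : TM E M) : Prop :=
  MDifferentiableAt (𝓘(ℝ, E).tangent) (𝓘(ℝ, E).tangent) Y.toMap w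

/-- The vector field `X` is of class `C^∞` on `s`. -/
def VField.SmoothOn (X : VField E M) (s : Set (TM E M)) : Prop :=
  ContMDiffOn (𝓘(ℝ, E).tangent) (𝓘(ℝ, E).tangent.tangent) ∞ X.toMap s

/-- The `π`-vector field `Y` is of class `C^∞` on `s`. -/
def PiField.SmoothOn (Y : PiField E M) (s : Set (TM E M)) : Prop :=
  ContMDiffOn (𝓘(ℝ, E).tangent) (𝓘(ℝ, E).tangent) ∞ Y.toMap s

/-- The bundle morphism `ρ : T(TM) → π⁻¹(TM)`, which is `dπ` on each tangent space. -/
def rho (w : TM E M) : TTan w →L[ℝ] PiFib w :=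
  mfderiv (𝓘(ℝ, E).tangent) 𝓘(ℝ, E) (TotalSpace.proj : TM E M → M) w

/-- The bundle morphism `γ : π⁻¹(TM) → T(TM)`: on the fibre over `w` it is the natural isomorphism
of `T_{π w} M` with the tangent space at `w` of the fibre `T_{π w} M`, i.e. the derivative at `w` of
the inclusion of this fibre into `TM`. -/
def gam (w : TM E M) : PiFib w →L[ℝ] TTan w :=
  mfderiv 𝓘(ℝ, E) (𝓘(ℝ, E).tangent) (fun y : E => (⟨w.proj, y⟩ : TM E M)) w.2

/-- The natural almost tangent structure `J = γ ∘ ρ`. -/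
def J (w : TM E M) : TTan w →L[ℝ] TTan w := (gam w).comp (rho w)

/-- The fundamental `π`-vector field `η`. -/
def eta : PiField E M := fun w => w.2

/-- The vector field `J X`. -/
def JField (X : VField E M) : VField E M := fun w => J w (X w)

/-- The `π`-vector field `ρ X`. -/
def rhoField (X : VField E M) : PiField E M := fun w => rho w (X w)

/-- The Lie bracket of vector fields on `TM`. -/
def bracket (X Y : VField E M) : VField E M := mlieBracket (𝓘(ℝ, E).tangent) X Y

/-- The differential of a function on `TM`. -/
def dFun (f : TM E M → ℝ) (w : TM E M) : TTan w →L[ℝ] ℝ := mvfderiv (𝓘(ℝ, E).tangent) f w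

/-- The semibasic 1-form `d_J f = i_J df = df ∘ J`. -/
def dJ (f : TM E M → ℝ) (w : TM E M) : TTan w →L[ℝ] ℝ := (dFun f w).comp (J w)

/-- The exterior derivative of a 1-form `θ`, evaluated on vector fields:
`dθ(X, Y) = X(θ(Y)) - Y(θ(X)) - θ([X, Y])`. -/
def dOne (θ : ∀ w : TM E M, TTan w →L[ℝ] ℝ) (X Y : VField E M) (w : TM E M) : ℝ :=
  dFun (fun z => θ z (Y z)) w (X w) - dFun (fun z => θ z (X z)) w (Y w) - θ w (bracket X Y w)

/-! ### Finsler structures -/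

/-- The energy `½ L²`. -/
def energy (L : TM E M → ℝ) (w : TM E M) : ℝ := L w ^ 2 / 2

/-- The Finsler metric `g` defined by `L`, a bilinear form on the fibres of `π⁻¹(TM)`: at `w` it is
the second derivative at `w` of the restriction of the energy to the tangent space `T_{π w} M`. -/
def metric (L : TM E M → ℝ) (w : TM E M) (a b : PiFib w) : ℝ :=
  fderiv ℝ (fun z : E => fderiv ℝ (fun y : E => energy L (⟨w.proj, y⟩ : TM E M)) z)
    (w.2 : E) (a : E) (b : E)

/-- `L` is a Finsler structure on `M`. -/
structure IsFinsler (L : TM E M → ℝ) : Prop where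
  continuous : Continuous L
  smooth : ContMDiffOn (𝓘(ℝ, E).tangent) 𝓘(ℝ, ℝ) ∞ L (slit E M)
  pos : ∀ w ∈ slit E M, 0 < L w
  homogeneous : ∀ (w : TM E M) (c : ℝ), 0 < c → L (⟨w.proj, c • w.2⟩ : TM E M) = c * L w
  posDef : ∀ w ∈ slit E M, ∀ a : PiFib w, a ≠ 0 → 0 < metric L w a a

/-- `G` is the canonical spray of `L`: the vector field on `𝒯M` with `i_G Ω = -dE`, where
`E = ½ L²` and `Ω = d d_J E`. -/
structure IsCanonicalSpray (L : TM E M → ℝ) (G : VField E M) : Prop where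
  smooth : G.SmoothOn (slit E M)
  eq : ∀ w ∈ slit E M, ∀ X : VField E M, X.DiffAt w →
    dOne (dJ (energy L)) G X w = -dFun (energy L) w (X w)

/-- `Γ` is the Barthel connection of `L` on `𝒯M`: the vector 1-form `[J, G]`
(Frölicher–Nijenhuis bracket), `[J, G] X = [J X, G] - J [X, G]`, where `G` is the canonical
spray of `L`. -/
def IsBarthel (L : TM E M → ℝ) (Γ : ∀ w : TM E M, TTan w →L[ℝ] TTan w) : Prop :=
  ∃ G : VField E M, IsCanonicalSpray L G ∧
    ∀ w ∈ slit E M, ∀ X : VField E M, X.DiffAt w →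
      Γ w (X w) = bracket (JField X) G w - J w (bracket X G w)

/-- The horizontal projector `½ (I + Γ)` of a nonlinear connection `Γ`. -/
def hProj (Γ : ∀ w : TM E M, TTan w →L[ℝ] TTan w) (w : TM E M) : TTan w →L[ℝ] TTan w :=
  (1 / 2 : ℝ) • (ContinuousLinearMap.id ℝ (TTan w) + Γ w)

/-- The vertical projector `½ (I - Γ)` of a nonlinear connection `Γ`. -/
def vProj (Γ : ∀ w : TM E M, TTan w →L[ℝ] TTan w) (w : TM E M) : TTan w →L[ℝ] TTan w :=
  (1 / 2 : ℝ) • (ContinuousLinearMap.id ℝ (TTan w) - Γ w)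

/-! ### Linear connections on the pullback bundle -/

variable (E M) in
/-- A smooth linear connection on the bundle `π⁻¹(TM)` over `𝒯M`. `D Y w x` is `D_x Y` for
`x ∈ T_w (𝒯M)`. As `D Y` at `w` depends only on the 1-jet of `Y` at `w`, the rules are stated for all
sections that are differentiable at `w`. -/
structure PiConnection where
  /-- The covariant derivative. -/
  D : PiField E M → ∀ w : TM E M, TTan w →L[ℝ] PiFib w
  add : ∀ w ∈ slit E M, ∀ Y Z : PiField E M, Y.DiffAt w → Z.DiffAt w →
    D (fun z => Y z + Z z) w = D Y w + D Z w
  leibniz : ∀ w ∈ slit E M, ∀ (f : TM E M → ℝ) (Y : PiField E M),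
    MDifferentiableAt (𝓘(ℝ, E).tangent) 𝓘(ℝ, ℝ) f w → Y.DiffAt w →
    D (fun z => f z • Y z) w = f w • D Y w + (dFun f w).smulRight (Y w)
  smooth : ∀ s : Set (TM E M), IsOpen s → s ⊆ slit E M → ∀ (X : VField E M) (Y : PiField E M),
    X.SmoothOn s → Y.SmoothOn s → PiField.SmoothOn (fun w => D Y w (X w)) s

/-- The connection (deflection) map `K : X ↦ D_X η`. -/
def PiConnection.K (D : PiConnection E M) (w : TM E M) : TTan w →L[ℝ] PiFib w := D.D eta w

/-- The connection is regular: `T_w(𝒯M)` is the direct sum of the vertical space `ker ρ` and the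
horizontal space `ker K`. -/
def PiConnection.IsRegular (D : PiConnection E M) : Prop :=
  ∀ w ∈ slit E M, IsCompl (LinearMap.ker (rho w : TTan w →ₗ[ℝ] PiFib w))
    (LinearMap.ker (D.K w : TTan w →ₗ[ℝ] PiFib w))

/-- The classical torsion `𝐓(X, Y) = D_X ρY - D_Y ρX - ρ[X, Y]`. -/
def PiConnection.torsion (D : PiConnection E M) (X Y : VField E M) : PiField E M :=
  fun w => D.D (rhoField Y) w (X w) - D.D (rhoField X) w (Y w) - rho w (bracket X Y w)

/-- `D` is the Cartan connection of `L`: it is regular and metric, its (h)h-torsion vanishes, and its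
(h)hv-torsion `T` satisfies `g(T(X, Y), Z) = g(T(X, Z), Y)`. As the torsion is a tensor, these
conditions are stated at `w` with vector fields which are horizontal or vertical at `w`. -/
structure IsCartan (L : TM E M → ℝ) (D : PiConnection E M) : Prop where
  regular : D.IsRegular
  metric_compatible : ∀ w ∈ slit E M, ∀ Y Z : PiField E M, Y.DiffAt w → Z.DiffAt w → ∀ x : TTan w,
    dFun (fun z => metric L z (Y z) (Z z)) w x =
      metric L w (D.D Y w x) (Z w) + metric L w (Y w) (D.D Z w x)
  hh_torsion : ∀ w ∈ slit E M, ∀ X Y : VField E M, X.DiffAt w → Y.DiffAt w →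
    D.K w (X w) = 0 → D.K w (Y w) = 0 → D.torsion X Y w = 0
  hhv_torsion : ∀ w ∈ slit E M, ∀ X Y Z : VField E M, X.DiffAt w → Y.DiffAt w → Z.DiffAt w →
    rho w (X w) = 0 → D.K w (Y w) = 0 → D.K w (Z w) = 0 →
    metric L w (D.torsion X Y w) (rho w (Z w)) = metric L w (D.torsion X Z w) (rho w (Y w))

/-- `ζ` is a concurrent `π`-vector field of `L`: it is smooth on `𝒯M` and `∇ζ = -ρ`, where `∇` is the
Cartan connection of `L`. -/
def IsConcurrent (L : TM E M → ℝ) (ζ : PiField E M) : Prop :=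
  ζ.SmoothOn (slit E M) ∧ ∃ D : PiConnection E M, IsCartan L D ∧
    ∀ w ∈ slit E M, D.D ζ w = -rho w

/-- `L'` is obtained from `L` by the energy `β`-change with the `π`-vector field `ζ`:
`L'² = L² + B²` with `B = g(ζ, η)`. -/
def IsEnergyChange (L L' : TM E M → ℝ) (ζ : PiField E M) : Prop :=
  ∀ w ∈ slit E M, L' w ^ 2 = L w ^ 2 + metric L w (ζ w) (eta w) ^ 2

/-- The vector 1-form `ℒ = - (d_J E / (1 + p²)) ⊗ γ ζ`, where `p² = g(ζ, ζ)`. -/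
def changeForm (L : TM E M → ℝ) (ζ : PiField E M) (w : TM E M) : TTan w →L[ℝ] TTan w :=
  -((1 / (1 + metric L w (ζ w) (ζ w))) • dJ (energy L) w).smulRight (gam w (ζ w))

end Finsler

end

/-! Work in a chart of `TM` with position x and fibre coordinate y, writing E for the energy of `L`
and P for p². Euler's relation and nondegeneracy of g turn the spray equation into a pointwise
characterisation: G is the vector `(y, s)` with Hess E(G, (0, c)) = dE(c, 0) for every c. The
theorem then amounts to comparing two such vectors and differentiating their difference along the
fibres.

Concurrence makes B very simple. Metricity gives dP = -2 g(ρ·, ζ), so P depends on position alone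
and B = -½ dP(y, 0) is an exact 1-form of the base evaluated on y. In the equation for the spray G'
of E + B²/2, the terms carrying the factor B therefore cancel, by symmetry of Hess P, and what
remains is G' = G - dB(G') γζ. Applying dB, whose fibre part is g(ζ, ·), gives (1 + p²) dB(G') =
dB(G). The spray is horizontal for the Cartan connection, so dB(G) = g(∇_G ζ, η) = -L². Hence G' = G
+ (2E / (1 + p²)) γζ, which is `IsEnergyChange.spray_eq`.

Passing to Barthel connections, a vertical correction fγζ of the spray changes [J, G] by the fibre
derivative of fζ. Neither P nor the components of ζ depend on y
(`IsConcurrent.fderiv_coordP_vertical`), so only the numerator 2E is differentiated, and this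
produces 2 d_J E / (1 + p²) ⊗ γζ. -/

noncomputable section

namespace Finsler

universe u v

variable {E : Type u} [NormedAddCommGroup E] [NormedSpace ℝ E]
  {M : Type v} [TopologicalSpace M] [ChartedSpace E M] [IsManifold 𝓘(ℝ, E) ∞ M]

/-! ### Coordinates on the tangent bundle -/

/-- The chart of `TM` around `w₀` induced by the chart of `M` around the foot of `w₀`. -/
def ch (w₀ : TM E M) : PartialEquiv (TM E M) (E × E) := extChartAt (𝓘(ℝ, E).tangent) w₀

/-- The derivative at `w` of the chart of `TM` around `w₀`. -/
def dch (w₀ w : TM E M) : TTan w →L[ℝ] E × E :=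
  mfderiv (𝓘(ℝ, E).tangent) 𝓘(ℝ, E × E) (extChartAt (𝓘(ℝ, E).tangent) w₀) w

/-- The derivative at the foot of `w` of the chart of `M` around the foot of `w₀`. -/
def dbase (w₀ w : TM E M) : PiFib w →L[ℝ] E :=
  mfderiv 𝓘(ℝ, E) 𝓘(ℝ, E) (extChartAt 𝓘(ℝ, E) w₀.proj) w.proj

theorem mem_ch_source {w₀ w : TM E M} :
    w ∈ (ch w₀).source ↔ w.proj ∈ (chartAt E w₀.proj).source := by
  rw [ch, extChartAt_source, TangentBundle.mem_chart_source_iff]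

/-- Hence a chart of `TM` is a base chart paired with its derivative, which is linear on each fibre;
the coordinate formulas below rest on this. -/
theorem trivializationAt_snd {F H N : Type*} [NormedAddCommGroup F] [NormedSpace ℝ F]
    [TopologicalSpace H] {I : ModelWithCorners ℝ F H} [TopologicalSpace N] [ChartedSpace H N]
    [IsManifold I 1 N] {x : N} {w : TangentBundle I N} (h : w.proj ∈ (chartAt H x).source) :
    (trivializationAt F (TangentSpace I) x w).2 =
      mfderiv I 𝓘(ℝ, F) (extChartAt I x) w.proj w.2 := by
  have h' : w.proj ∈ (trivializationAt F (TangentSpace I) x).baseSet := h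
  have h1 := TangentBundle.continuousLinearMapAt_trivializationAt (I := I) h
  have h2 : (trivializationAt F (TangentSpace I) x).continuousLinearMapAt ℝ w.proj w.2 =
      (trivializationAt F (TangentSpace I) x w).2 := by
    rw [Bundle.Trivialization.continuousLinearMapAt_apply,
      Bundle.Trivialization.linearMapAt_apply, if_pos h']
  exact h2.symm.trans (congrArg (fun A : TangentSpace I w.proj →L[ℝ] F => A w.2) h1)

theorem ch_apply {w₀ w : TM E M} (hw : w ∈ (ch w₀).source) :
    ch w₀ w = (extChartAt 𝓘(ℝ, E) w₀.proj w.proj, dbase w₀ w w.2) := by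
  exact Prod.ext rfl (trivializationAt_snd (mem_ch_source.1 hw))

theorem isOpen_ch_source (w₀ : TM E M) : IsOpen (ch w₀).source := isOpen_extChartAt_source w₀

theorem isOpen_ch_target (w₀ : TM E M) : IsOpen (ch w₀).target := isOpen_extChartAt_target w₀

theorem mem_ch_source_self (w₀ : TM E M) : w₀ ∈ (ch w₀).source := mem_extChartAt_source w₀

theorem ch_target_mem_nhds {w₀ w : TM E M} (hw : w ∈ (ch w₀).source) :
    (ch w₀).target ∈ 𝓝 (ch w₀ w) :=
  (isOpen_ch_target w₀).mem_nhds ((ch w₀).map_source hw)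

theorem contMDiffAt_ch {w₀ w : TM E M} (hw : w ∈ (ch w₀).source) :
    ContMDiffAt (𝓘(ℝ, E).tangent) 𝓘(ℝ, E × E) ∞ (ch w₀) w :=
  contMDiffAt_extChartAt' (by rwa [ch, extChartAt_source] at hw)

theorem contMDiffAt_ch_symm {w₀ : TM E M} {z : E × E} (hz : z ∈ (ch w₀).target) :
    ContMDiffAt 𝓘(ℝ, E × E) (𝓘(ℝ, E).tangent) ∞ (ch w₀).symm z :=
  (contMDiffOn_extChartAt_symm w₀).contMDiffAt ((isOpen_ch_target w₀).mem_nhds hz)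

/-- A preferred chart has identity derivative at its own centre, so a tangent vector at `w`, which
is by definition an element of `E × E`, is its own coordinate expression there. Pointwise identities
at `w` are therefore computed in the chart around `w`. -/
theorem dch_self (w : TM E M) : dch w w = ContinuousLinearMap.id ℝ (E × E) := by
  unfold dch
  rw [mfderiv_extChartAt_self]
  rfl

theorem dbase_self (w : TM E M) : dbase w w = ContinuousLinearMap.id ℝ E := by
  unfold dbase
  rw [mfderiv_extChartAt_self]
  rfl

theorem isInvertible_dch {w₀ w : TM E M} (hw : w ∈ (ch w₀).source) : (dch w₀ w).IsInvertible :=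
  isInvertible_mfderiv_extChartAt hw

theorem isInvertible_dbase {w₀ w : TM E M} (hw : w ∈ (ch w₀).source) :
    (dbase w₀ w).IsInvertible :=
  isInvertible_mfderiv_extChartAt (by rw [extChartAt_source]; exact mem_ch_source.1 hw)

theorem dbase_rho {w₀ w : TM E M} (hw : w ∈ (ch w₀).source) (x : TTan w) :
    dbase w₀ w (rho w x) = (dch w₀ w x).1 := by
  have hb : MDifferentiableAt 𝓘(ℝ, E) 𝓘(ℝ, E) (extChartAt 𝓘(ℝ, E) w₀.proj) w.proj :=
    mdifferentiableAt_extChartAt (mem_ch_source.1 hw)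
  have hp : MDifferentiableAt (𝓘(ℝ, E).tangent) 𝓘(ℝ, E) (TotalSpace.proj : TM E M → M) w :=
    ((contMDiff_proj (TangentSpace 𝓘(ℝ, E)) (n := ∞)).contMDiffAt).mdifferentiableAt (by simp)
  have hc : MDifferentiableAt (𝓘(ℝ, E).tangent) 𝓘(ℝ, E × E) (ch w₀) w :=
    (contMDiffAt_ch hw).mdifferentiableAt (by simp)
  have h1 := mfderiv_comp w hb hp
  have h2 : mfderiv (𝓘(ℝ, E).tangent) 𝓘(ℝ, E) ((Prod.fst : E × E → E) ∘ ch w₀) w =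
      (ContinuousLinearMap.fst ℝ E E).comp (dch w₀ w) := by
    refine (mfderiv_comp w (I' := 𝓘(ℝ, E × E)) ?_ hc).trans ?_
    · exact differentiableAt_fst.mdifferentiableAt
    · rw [mfderiv_eq_fderiv, fderiv_fst]
      rfl
  have h3 : (extChartAt 𝓘(ℝ, E) w₀.proj) ∘ (TotalSpace.proj : TM E M → M) =ᶠ[𝓝 w]
      (Prod.fst : E × E → E) ∘ ch w₀ := by
    filter_upwards [(isOpen_ch_source w₀).mem_nhds hw] with w' hw'
    simp only [Function.comp_apply, ch_apply hw']
  rw [h3.mfderiv_eq] at h1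
  rw [h1] at h2
  exact congrArg (fun A : (E × E) →L[ℝ] E => A x) h2

theorem contMDiff_fibre_inclusion (x : M) :
    ContMDiff 𝓘(ℝ, E) (𝓘(ℝ, E).tangent) ∞ (fun y : E => (⟨x, y⟩ : TM E M)) := by
  intro y
  refine contMDiffAt_totalSpace.2 ⟨contMDiffAt_const, ?_⟩
  have h : (fun y : E => (trivializationAt E (TangentSpace 𝓘(ℝ, E)) x (⟨x, y⟩ : TM E M)).2) =
      (mfderiv 𝓘(ℝ, E) 𝓘(ℝ, E) (extChartAt 𝓘(ℝ, E) x) x : E →L[ℝ] E) := by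
    ext1 y
    exact trivializationAt_snd (w := (⟨x, y⟩ : TM E M)) (mem_chart_source E x)
  change ContMDiffAt _ _ _
    (fun y : E => (trivializationAt E (TangentSpace 𝓘(ℝ, E)) x (⟨x, y⟩ : TM E M)).2) y
  rw [h]
  exact (ContinuousLinearMap.contDiff (𝕜 := ℝ) (E := E) (F := E) _).contMDiff y

theorem dch_gam {w₀ w : TM E M} (hw : w ∈ (ch w₀).source) (a : PiFib w) :
    dch w₀ w (gam w a) = (0, dbase w₀ w a) := by
  have hc : MDifferentiableAt (𝓘(ℝ, E).tangent) 𝓘(ℝ, E × E) (ch w₀) w :=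
    (contMDiffAt_ch hw).mdifferentiableAt (by simp)
  have h1 := mfderiv_comp (I := 𝓘(ℝ, E)) (f := fun y : E => (⟨w.proj, y⟩ : TM E M))
    (w.2 : E) hc ((contMDiff_fibre_inclusion w.proj _).mdifferentiableAt (by simp))
  have h2 : ch w₀ ∘ (fun y : E => (⟨w.proj, y⟩ : TM E M)) =
      fun y : E => (extChartAt 𝓘(ℝ, E) w₀.proj w.proj, (dbase w₀ w : E →L[ℝ] E) y) := by
    ext1 y
    exact ch_apply (mem_ch_source.2 (mem_ch_source.1 hw))
  have h3 : HasFDerivAt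
      (fun y : E => (extChartAt 𝓘(ℝ, E) w₀.proj w.proj, (dbase w₀ w : E →L[ℝ] E) y))
      ((0 : E →L[ℝ] E).prod (dbase w₀ w : E →L[ℝ] E)) (w.2 : E) :=
    (hasFDerivAt_const _ _).prodMk (dbase w₀ w : E →L[ℝ] E).hasFDerivAt
  rw [h2] at h1
  exact (congrArg (fun A : E →L[ℝ] E × E => A a) (h3.hasMFDerivAt.mfderiv.symm.trans h1)).symm

/-! ### Coordinate expressions -/

/-- The coordinate expression of a vector field on `TM`. -/
def coordV (w₀ : TM E M) (X : VField E M) (z : E × E) : E × E :=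
  dch w₀ ((ch w₀).symm z) (X ((ch w₀).symm z))

/-- The coordinate expression of a `π`-vector field. -/
def coordP (w₀ : TM E M) (Y : PiField E M) (z : E × E) : E :=
  dbase w₀ ((ch w₀).symm z) (Y ((ch w₀).symm z))

/-- The coordinate expression of a function on `TM`. -/
def coordF (w₀ : TM E M) (f : TM E M → ℝ) (z : E × E) : ℝ := f ((ch w₀).symm z)

/-- The vector field with constant coordinates `c`. -/
def constV (w₀ : TM E M) (c : E × E) : VField E M := fun w => (dch w₀ w).inverse c

/-- The `π`-vector field with constant coordinates `a`. -/
def constP (w₀ : TM E M) (a : E) : PiField E M := fun w => (dbase w₀ w).inverse a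

theorem coordV_constV {w₀ : TM E M} (c : E × E) {z : E × E} (hz : z ∈ (ch w₀).target) :
    coordV w₀ (constV w₀ c) z = c :=
  (isInvertible_dch ((ch w₀).map_target hz)).self_apply_inverse c

theorem coordP_constP {w₀ : TM E M} (a : E) {z : E × E} (hz : z ∈ (ch w₀).target) :
    coordP w₀ (constP w₀ a) z = a :=
  (isInvertible_dbase ((ch w₀).map_target hz)).self_apply_inverse a

theorem coordP_rhoField {w₀ : TM E M} (X : VField E M) {z : E × E} (hz : z ∈ (ch w₀).target) :
    coordP w₀ (rhoField X) z = (coordV w₀ X z).1 :=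
  dbase_rho ((ch w₀).map_target hz) _

theorem coordV_gam {w₀ : TM E M} (Y : PiField E M) {z : E × E} (hz : z ∈ (ch w₀).target) :
    coordV w₀ (fun w => gam w (Y w)) z = (0, coordP w₀ Y z) :=
  dch_gam ((ch w₀).map_target hz) _

theorem coordV_JField {w₀ : TM E M} (X : VField E M) {z : E × E} (hz : z ∈ (ch w₀).target) :
    coordV w₀ (JField X) z = (0, (coordV w₀ X z).1) := by
  rw [← coordP_rhoField X hz, ← coordV_gam _ hz]
  rfl

theorem coordP_eta {w₀ : TM E M} {z : E × E} (hz : z ∈ (ch w₀).target) :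
    coordP w₀ eta z = z.2 := by
  have h := ch_apply ((ch w₀).map_target hz)
  rw [(ch w₀).right_inv hz] at h
  exact (congrArg Prod.snd h).symm

theorem coordV_self (w : TM E M) (X : VField E M) : coordV w X (ch w w) = X w := by
  unfold coordV
  rw [(ch w).left_inv (mem_ch_source_self w), dch_self]
  rfl

theorem coordP_self (w : TM E M) (Y : PiField E M) : coordP w Y (ch w w) = Y w := by
  unfold coordP
  rw [(ch w).left_inv (mem_ch_source_self w), dbase_self]
  rfl

theorem rho_self (w : TM E M) (x : E × E) : rho w x = x.1 := by
  have := dbase_rho (mem_ch_source_self w) x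
  rw [dch_self, dbase_self] at this
  exact this

theorem gam_self (w : TM E M) (a : E) : gam w a = ((0, a) : E × E) := by
  have := dch_gam (mem_ch_source_self w) a
  rw [dch_self, dbase_self] at this
  exact this

/-! ### Regularity in coordinates -/

theorem ch_symm_mem_slit {w₀ : TM E M} {z : E × E} (hz : z ∈ (ch w₀).target) :
    (ch w₀).symm z ∈ slit E M ↔ z.2 ≠ 0 := by
  have hs := (ch w₀).map_target hz
  have h := coordP_eta hz
  obtain ⟨A, hA⟩ := isInvertible_dbase hs
  have h1 : A ((ch w₀).symm z).2 = z.2 := by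
    rw [← h]
    exact congrArg (fun B : E →L[ℝ] E => B ((ch w₀).symm z).2) hA
  rw [← h1]
  exact (not_congr (map_eq_zero_iff A A.injective)).symm

theorem ch_self_snd (w : TM E M) : (ch w w).2 = w.2 := by
  rw [ch_apply (mem_ch_source_self w), dbase_self]
  rfl

theorem eventually_target {w₀ w : TM E M} (hw : w ∈ (ch w₀).source) :
    ∀ᶠ z in 𝓝 (ch w₀ w), z ∈ (ch w₀).target := ch_target_mem_nhds hw

theorem eventually_slit {w : TM E M} (hw : w ∈ slit E M) :
    ∀ᶠ z in 𝓝 (ch w w), (ch w).symm z ∈ slit E M := by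
  have h : ∀ᶠ z in 𝓝 (ch w w), z.2 ≠ 0 :=
    continuousAt_snd.eventually_ne (by rw [ch_self_snd]; exact hw)
  filter_upwards [h, eventually_target (mem_ch_source_self w)] with z h1 h2
  exact (ch_symm_mem_slit h2).2 h1

theorem tendsto_ch {w₀ w : TM E M} (hw : w ∈ (ch w₀).source) :
    Filter.Tendsto (ch w₀) (𝓝 w) (𝓝 (ch w₀ w)) :=
  (contMDiffAt_ch hw).continuousAt

theorem slit_mem_nhds {w : TM E M} (hw : w ∈ slit E M) : slit E M ∈ 𝓝 w := by
  filter_upwards [(tendsto_ch (mem_ch_source_self w)).eventually (eventually_slit hw),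
    (isOpen_ch_source w).mem_nhds (mem_ch_source_self w)] with w' h1 h2
  rwa [(ch w).left_inv h2] at h1

theorem mdifferentiableAt_iff_coord {F : Type*} [NormedAddCommGroup F] [NormedSpace ℝ F]
    {w₀ w : TM E M} (hw : w ∈ (ch w₀).source) {g : TM E M → F} :
    MDifferentiableAt (𝓘(ℝ, E).tangent) 𝓘(ℝ, F) g w ↔
      DifferentiableAt ℝ (fun z => g ((ch w₀).symm z)) (ch w₀ w) := by
  constructor
  · intro h
    rw [← (ch w₀).left_inv hw] at h
    exact (h.comp (ch w₀ w)
      ((contMDiffAt_ch_symm ((ch w₀).map_source hw)).mdifferentiableAt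
        (by simp))).differentiableAt
  · intro h
    refine (h.mdifferentiableAt.comp w
      ((contMDiffAt_ch hw).mdifferentiableAt (by simp))).congr_of_eventuallyEq ?_
    filter_upwards [(isOpen_ch_source w₀).mem_nhds hw] with w' hw'
    simp only [Function.comp_apply, (ch w₀).left_inv hw']

theorem contDiffAt_coord {F : Type*} [NormedAddCommGroup F] [NormedSpace ℝ F]
    {w₀ w : TM E M} (hw : w ∈ (ch w₀).source) {g : TM E M → F}
    (h : ContMDiffAt (𝓘(ℝ, E).tangent) 𝓘(ℝ, F) ∞ g w) :
    ContDiffAt ℝ ∞ (fun z => g ((ch w₀).symm z)) (ch w₀ w) := by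
  rw [← (ch w₀).left_inv hw] at h
  exact (h.comp (ch w₀ w) (contMDiffAt_ch_symm ((ch w₀).map_source hw))).contDiffAt

theorem eventually_mem_source (w : TM E M) : ∀ᶠ w' in 𝓝 w, w' ∈ (ch w).source :=
  (isOpen_ch_source w).mem_nhds (mem_ch_source_self w)

theorem VField.toMap_snd (X : VField E M) {w w' : TM E M} (h : w' ∈ (ch w).source) :
    (trivializationAt (E × E) (TangentSpace (𝓘(ℝ, E).tangent)) (X.toMap w).proj
      (X.toMap w')).2 = dch w w' (X w') :=
  trivializationAt_snd (w := X.toMap w') (by rwa [ch, extChartAt_source] at h)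

theorem PiField.toMap_snd (Y : PiField E M) {w w' : TM E M} (h : w' ∈ (ch w).source) :
    (trivializationAt E (TangentSpace 𝓘(ℝ, E)) (Y.toMap w).proj (Y.toMap w')).2 =
      dbase w w' (Y w') :=
  trivializationAt_snd (I := 𝓘(ℝ, E)) (x := w.proj)
    (w := (⟨w'.proj, Y w'⟩ : TangentBundle 𝓘(ℝ, E) M)) (mem_ch_source.1 h)

theorem VField.diffAt_iff {X : VField E M} {w : TM E M} :
    X.DiffAt w ↔ DifferentiableAt ℝ (coordV w X) (ch w w) := by
  refine (mdifferentiableAt_totalSpace _ _).trans ?_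
  refine (and_iff_right (by exact mdifferentiableAt_id)).trans ?_
  refine Iff.trans ?_ (mdifferentiableAt_iff_coord (g := fun w' => (dch w w' (X w') : E × E))
    (mem_ch_source_self w))
  refine Filter.EventuallyEq.mdifferentiableAt_iff ?_
  filter_upwards [eventually_mem_source w] with w' h using X.toMap_snd h

theorem PiField.diffAt_iff {Y : PiField E M} {w : TM E M} :
    Y.DiffAt w ↔ DifferentiableAt ℝ (coordP w Y) (ch w w) := by
  refine (mdifferentiableAt_totalSpace _ _).trans ?_
  refine (and_iff_right (by
    exact (contMDiff_proj (TangentSpace 𝓘(ℝ, E)) (n := ∞)).contMDiffAt.mdifferentiableAt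
      (by simp))).trans ?_
  refine Iff.trans ?_ (mdifferentiableAt_iff_coord (g := fun w' => (dbase w w' (Y w') : E))
    (mem_ch_source_self w))
  refine Filter.EventuallyEq.mdifferentiableAt_iff ?_
  filter_upwards [eventually_mem_source w] with w' h using Y.toMap_snd h

theorem VField.SmoothOn.contDiffAt_coordV {X : VField E M} {w : TM E M} (hw : w ∈ slit E M)
    (h : X.SmoothOn (slit E M)) : ContDiffAt ℝ ∞ (coordV w X) (ch w w) := by
  have h1 := (contMDiffAt_totalSpace.1 (h.contMDiffAt (slit_mem_nhds hw))).2
  refine contDiffAt_coord (g := fun w' => (dch w w' (X w') : E × E))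
    (mem_ch_source_self w) (h1.congr_of_eventuallyEq ?_)
  filter_upwards [eventually_mem_source w] with w' h using (X.toMap_snd h).symm

theorem PiField.SmoothOn.contDiffAt_coordP {Y : PiField E M} {w : TM E M} (hw : w ∈ slit E M)
    (h : Y.SmoothOn (slit E M)) : ContDiffAt ℝ ∞ (coordP w Y) (ch w w) := by
  have h1 := (contMDiffAt_totalSpace.1 (h.contMDiffAt (slit_mem_nhds hw))).2
  refine contDiffAt_coord (g := fun w' => (dbase w w' (Y w') : E))
    (mem_ch_source_self w) (h1.congr_of_eventuallyEq ?_)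
  filter_upwards [eventually_mem_source w] with w' h using (Y.toMap_snd h).symm

theorem diffAt_constV (w : TM E M) (c : E × E) : (constV w c).DiffAt w := by
  refine VField.diffAt_iff.2 ((differentiableAt_const c).congr_of_eventuallyEq ?_)
  filter_upwards [eventually_target (mem_ch_source_self w)] with z hz using coordV_constV c hz

theorem diffAt_constP (w : TM E M) (a : E) : (constP w a).DiffAt w := by
  refine PiField.diffAt_iff.2 ((differentiableAt_const a).congr_of_eventuallyEq ?_)
  filter_upwards [eventually_target (mem_ch_source_self w)] with z hz using coordP_constP a hz

theorem diffAt_eta (w : TM E M) : (eta : PiField E M).DiffAt w := by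
  refine PiField.diffAt_iff.2 (differentiableAt_snd.congr_of_eventuallyEq ?_)
  filter_upwards [eventually_target (mem_ch_source_self w)] with z hz using coordP_eta hz

theorem constV_self (w : TM E M) (c : E × E) : constV w c w = c :=
  (coordV_self w (constV w c)).symm.trans
    (coordV_constV c ((ch w).map_source (mem_ch_source_self w)))

theorem constP_self (w : TM E M) (a : E) : constP w a w = a :=
  (coordP_self w (constP w a)).symm.trans
    (coordP_constP a ((ch w).map_source (mem_ch_source_self w)))

/-! ### Differentials and brackets in coordinates -/

theorem dFun_eq {w₀ w : TM E M} (hw : w ∈ (ch w₀).source) {f : TM E M → ℝ}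
    (hf : MDifferentiableAt (𝓘(ℝ, E).tangent) 𝓘(ℝ, ℝ) f w) (x : TTan w) :
    dFun f w x = fderiv ℝ (coordF w₀ f) (ch w₀ w) (dch w₀ w x) := by
  have h1 := mfderiv_comp w ((mdifferentiableAt_iff_coord hw).1 hf).mdifferentiableAt
    ((contMDiffAt_ch hw).mdifferentiableAt (by simp))
  have h2 : (fun z => f ((ch w₀).symm z)) ∘ ch w₀ =ᶠ[𝓝 w] f := by
    filter_upwards [(isOpen_ch_source w₀).mem_nhds hw] with w' hw'
    simp only [Function.comp_apply, (ch w₀).left_inv hw']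
  rw [h2.mfderiv_eq, mfderiv_eq_fderiv] at h1
  exact congrArg (fun A : TTan w →L[ℝ] ℝ => A x) h1

theorem dFun_self {w : TM E M} {f : TM E M → ℝ}
    (hf : DifferentiableAt ℝ (coordF w f) (ch w w)) (x : E × E) :
    dFun f w x = fderiv ℝ (coordF w f) (ch w w) x := by
  have h := dFun_eq (mem_ch_source_self w)
    ((mdifferentiableAt_iff_coord (mem_ch_source_self w)).2 hf) x
  rw [dch_self] at h
  exact h

/-- The derivatives of the chart and of its inverse are mutually inverse, so the pullback used to
define the manifold Lie bracket is the coordinate expression. -/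
theorem mpullbackWithin_ch_symm {w₀ : TM E M} (X : VField E M) {z : E × E}
    (hz : z ∈ (ch w₀).target) :
    mpullbackWithin 𝓘(ℝ, E × E) (𝓘(ℝ, E).tangent) (extChartAt (𝓘(ℝ, E).tangent) w₀).symm X
      (range (𝓘(ℝ, E).tangent)) z = coordV w₀ X z := by
  have h := ContinuousLinearMap.inverse_eq
    (mfderivWithin_extChartAt_symm_comp_mfderiv_extChartAt (I := 𝓘(ℝ, E).tangent) hz)
    (mfderiv_extChartAt_comp_mfderivWithin_extChartAt_symm (I := 𝓘(ℝ, E).tangent) hz)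
  exact congrArg (fun A : TTan ((ch w₀).symm z) →L[ℝ] E × E => A (X ((ch w₀).symm z))) h

theorem bracket_self (X Y : VField E M) (w : TM E M) :
    bracket X Y w = lieBracket ℝ (coordV w X) (coordV w Y) (ch w w) := by
  have hr : ((extChartAt (𝓘(ℝ, E).tangent) w).symm ⁻¹' univ ∩ range (𝓘(ℝ, E).tangent)) =
      (univ : Set (E × E)) := by
    rw [preimage_univ, univ_inter]
    exact ModelWithCorners.range_eq_univ _
  have h1 : bracket X Y w = (mfderiv (𝓘(ℝ, E).tangent) 𝓘(ℝ, E × E)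
      (extChartAt (𝓘(ℝ, E).tangent) w) w).inverse _ := mlieBracketWithin_apply
  rw [hr] at h1
  have h2 : (dch w w).inverse = ContinuousLinearMap.id ℝ (E × E) := by
    rw [dch_self]
    exact ContinuousLinearMap.inverse_id
  refine (h1.trans (congrArg (fun A : (E × E) →L[ℝ] (E × E) => A _) h2)).trans ?_
  have h3 : ∀ Z : VField E M, mpullbackWithin 𝓘(ℝ, E × E) (𝓘(ℝ, E).tangent)
      (extChartAt (𝓘(ℝ, E).tangent) w).symm Z (range (𝓘(ℝ, E).tangent)) =ᶠ[𝓝 (ch w w)]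
        coordV w Z := fun Z => by
    filter_upwards [eventually_target (mem_ch_source_self w)] with z hz
    exact mpullbackWithin_ch_symm Z hz
  refine Eq.trans ?_ ((h3 X).lieBracket_vectorField_eq (h3 Y))
  exact congrFun (lieBracketWithin_univ (𝕜 := ℝ) (E := E × E)) _

/-! ### The metric in coordinates -/

/-- The energy in coordinates. -/
abbrev coordE (w₀ : TM E M) (L : TM E M → ℝ) : E × E → ℝ := coordF w₀ (energy L)

theorem IsFinsler.contDiffAt_coordE {L : TM E M → ℝ} (hL : IsFinsler L) {w₀ w : TM E M}
    (hw : w ∈ slit E M) (h : w ∈ (ch w₀).source) : ContDiffAt ℝ ∞ (coordE w₀ L) (ch w₀ w) := by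
  have h1 := contDiffAt_coord h (hL.smooth.contMDiffAt (slit_mem_nhds hw))
  exact (h1.pow 2).div_const 2

/-- Chain rule applied twice along an affine map. With `A` the derivative of the base chart, it
identifies g with the fibre-fibre block of the Hessian of the energy in the chart. -/
theorem fderiv_fderiv_comp_prodMk {q : E × E → ℝ} {p : E} {A : E →L[ℝ] E} {y : E}
    (hq : ContDiffAt ℝ ∞ q (p, A y)) (a b : E) :
    fderiv ℝ (fun z : E => fderiv ℝ (fun y : E => q (p, A y)) z) y a b =
      fderiv ℝ (fderiv ℝ q) (p, A y) (0, A a) (0, A b) := by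
  set B : E →L[ℝ] E × E := (0 : E →L[ℝ] E).prod A
  have hi : ∀ y : E, HasFDerivAt (fun y : E => (p, A y)) B y := fun y =>
    (hasFDerivAt_const _ _).prodMk A.hasFDerivAt
  have hd : ∀ᶠ z in 𝓝 (p, A y), DifferentiableAt ℝ q z := by
    filter_upwards [(hq.of_le (m := 1) (by simp)).eventually (by simp)] with z hz
    exact hz.differentiableAt (by simp)
  have hf : (fun z : E => fderiv ℝ (fun y : E => q (p, A y)) z) =ᶠ[𝓝 y]
      fun z => (fderiv ℝ q (p, A z)).comp B := by
    have ht : Filter.Tendsto (fun y : E => (p, A y)) (𝓝 y) (𝓝 (p, A y)) :=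
      (hi _).continuousAt
    filter_upwards [ht.eventually hd] with z hz
    exact (hz.hasFDerivAt.comp z (hi z)).fderiv
  have hd2 : HasFDerivAt (fderiv ℝ q) (fderiv ℝ (fderiv ℝ q) (p, A y)) (p, A y) :=
    ((hq.fderiv_right (m := ∞) le_rfl).differentiableAt (by simp)).hasFDerivAt
  rw [(((hd2.comp y (hi y)).clm_comp (hasFDerivAt_const B y)).congr_of_eventuallyEq hf).fderiv]
  simp [B]

theorem metric_eq {L : TM E M → ℝ} (hL : IsFinsler L) {w₀ w : TM E M}
    (hw : w ∈ slit E M) (h : w ∈ (ch w₀).source) (a b : PiFib w) :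
    metric L w a b = fderiv ℝ (fderiv ℝ (coordE w₀ L)) (ch w₀ w) (0, dbase w₀ w a)
      (0, dbase w₀ w b) := by
  have hch := ch_apply h
  have hq := hL.contDiffAt_coordE hw h
  have he : (fun y : E => energy L (⟨w.proj, y⟩ : TM E M)) =
      fun y => coordE w₀ L (extChartAt 𝓘(ℝ, E) w₀.proj w.proj, (dbase w₀ w : E →L[ℝ] E) y) := by
    ext1 y
    have hy : (⟨w.proj, y⟩ : TM E M) ∈ (ch w₀).source := mem_ch_source.2 (mem_ch_source.1 h)
    have h1 : ch w₀ (⟨w.proj, y⟩ : TM E M) =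
      (extChartAt 𝓘(ℝ, E) w₀.proj w.proj, (dbase w₀ w : E →L[ℝ] E) y) := ch_apply hy
    rw [← h1]
    exact congrArg (energy L) ((ch w₀).left_inv hy).symm
  rw [hch] at hq ⊢
  unfold metric
  rw [he]
  exact fderiv_fderiv_comp_prodMk (E := E) (A := dbase w₀ w) (y := w.2) hq a b

theorem coordF_metric {L : TM E M → ℝ} (hL : IsFinsler L) {w₀ : TM E M} {z : E × E}
    (hz : z ∈ (ch w₀).target) (hs : (ch w₀).symm z ∈ slit E M) (Y Z : PiField E M) :
    coordF w₀ (fun w => metric L w (Y w) (Z w)) z =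
      fderiv ℝ (fderiv ℝ (coordE w₀ L)) z (0, coordP w₀ Y z) (0, coordP w₀ Z z) := by
  have := metric_eq hL hs ((ch w₀).map_target hz) (Y ((ch w₀).symm z)) (Z ((ch w₀).symm z))
  rw [(ch w₀).right_inv hz] at this
  exact this

/-! ### Second and third derivatives -/

section Calculus

variable {F : Type*} [NormedAddCommGroup F] [NormedSpace ℝ F] {q : F → ℝ} {z : F}

/-- The second derivative of a function on a normed space. -/
abbrev hess (q : F → ℝ) (z : F) : F →L[ℝ] F →L[ℝ] ℝ := fderiv ℝ (fderiv ℝ q) z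

/-- The third derivative of a function on a normed space. -/
def third (q : F → ℝ) (z a b c : F) : ℝ := fderiv ℝ (fderiv ℝ (fderiv ℝ q)) z a b c

theorem two_le_infty : (2 : WithTop ℕ∞) ≤ ∞ := WithTop.coe_le_coe.2 le_top

theorem contDiffAt_fderiv {G : Type*} [NormedAddCommGroup G] [NormedSpace ℝ G] {f : F → G}
    (h : ContDiffAt ℝ ∞ f z) : ContDiffAt ℝ ∞ (fderiv ℝ f) z := h.fderiv_right le_rfl

theorem differentiableAt_of_contDiffAt {G : Type*} [NormedAddCommGroup G] [NormedSpace ℝ G]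
    {f : F → G} (h : ContDiffAt ℝ ∞ f z) : DifferentiableAt ℝ f z := h.differentiableAt (by simp)

theorem eventually_contDiffAt_two {G : Type*} [NormedAddCommGroup G] [NormedSpace ℝ G] {f : F → G}
    (h : ContDiffAt ℝ ∞ f z) : ∀ᶠ x in 𝓝 z, ContDiffAt ℝ 2 f x :=
  (h.of_le two_le_infty).eventually (by simp)

theorem hess_comm (h : ContDiffAt ℝ 2 q z) (a b : F) : hess q z a b = hess q z b a :=
  h.isSymmSndFDerivAt (by simp) a b

theorem fderiv_fderiv_apply_of_two (h : ContDiffAt ℝ 2 q z) {V : F → F}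
    (hV : DifferentiableAt ℝ V z) (x : F) : fderiv ℝ (fun y => fderiv ℝ q y (V y)) z x =
      hess q z x (V z) + fderiv ℝ q z (fderiv ℝ V z x) := by
  have h1 : DifferentiableAt ℝ (fderiv ℝ q) z :=
    (h.fderiv_right (m := 1) (by norm_num)).differentiableAt one_ne_zero
  rw [(h1.hasFDerivAt.clm_apply hV.hasFDerivAt).fderiv]
  simp [add_comm]

theorem fderiv_fderiv_apply (h : ContDiffAt ℝ ∞ q z) {V : F → F} (hV : DifferentiableAt ℝ V z)
    (x : F) : fderiv ℝ (fun y => fderiv ℝ q y (V y)) z x =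
      hess q z x (V z) + fderiv ℝ q z (fderiv ℝ V z x) :=
  fderiv_fderiv_apply_of_two (h.of_le two_le_infty) hV x

theorem fderiv_hess_apply (h : ContDiffAt ℝ ∞ q z) {V W : F → F} (hV : DifferentiableAt ℝ V z)
    (hW : DifferentiableAt ℝ W z) (x : F) :
    fderiv ℝ (fun y => hess q y (V y) (W y)) z x =
      third q z x (V z) (W z) + hess q z (fderiv ℝ V z x) (W z) +
        hess q z (V z) (fderiv ℝ W z x) := by
  have h1 := differentiableAt_of_contDiffAt (contDiffAt_fderiv (contDiffAt_fderiv h))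
  rw [((h1.hasFDerivAt.clm_apply hV.hasFDerivAt).clm_apply
    hW.hasFDerivAt).fderiv]
  simp [third]
  ring

theorem third_comm_right (h : ContDiffAt ℝ ∞ q z) (a b c : F) :
    third q z a b c = third q z a c b := by
  have h1 := fderiv_hess_apply h (differentiableAt_const b) (differentiableAt_const c) a
  have h2 := fderiv_hess_apply h (differentiableAt_const c) (differentiableAt_const b) a
  have h3 : (fun y => hess q y b c) =ᶠ[𝓝 z] fun y => hess q y c b := by
    filter_upwards [eventually_contDiffAt_two h] with y hy using hess_comm hy b c
  rw [h3.fderiv_eq, h2] at h1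
  simpa using h1.symm

end Calculus

/-! ### Homogeneity -/

/-- The chart domain is described by the foot alone, so rescaling a fibre stays inside it, and the
chart commutes with the rescaling. -/
theorem IsFinsler.coordE_smul {L : TM E M → ℝ} (hL : IsFinsler L) {w₀ : TM E M} {z : E × E}
    (hz : z ∈ (ch w₀).target) {t : ℝ} (ht : 0 < t) :
    coordE w₀ L (z.1, t • z.2) = t ^ 2 * coordE w₀ L z := by
  set u := (ch w₀).symm z
  have hu : u ∈ (ch w₀).source := (ch w₀).map_target hz
  have hu' : (⟨u.proj, t • u.2⟩ : TM E M) ∈ (ch w₀).source :=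
    mem_ch_source.2 (mem_ch_source.1 hu)
  have h1 : z = (extChartAt 𝓘(ℝ, E) w₀.proj u.proj, dbase w₀ u u.2) :=
    ((ch w₀).right_inv hz).symm.trans (ch_apply hu)
  have h2 : ch w₀ (⟨u.proj, t • u.2⟩ : TM E M) = (z.1, t • z.2) := by
    rw [h1]
    exact (ch_apply hu').trans (Prod.ext rfl (map_smul (dbase w₀ u) t u.2))
  have h3 : (ch w₀).symm (z.1, t • z.2) = (⟨u.proj, t • u.2⟩ : TM E M) := by
    rw [← h2, (ch w₀).left_inv hu']
  unfold coordE coordF energy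
  rw [h3, hL.homogeneous u t ht]
  ring

theorem IsFinsler.euler {L : TM E M → ℝ} (hL : IsFinsler L) {w₀ : TM E M} {z : E × E}
    (hz : z ∈ (ch w₀).target) (hs : (ch w₀).symm z ∈ slit E M) :
    fderiv ℝ (coordE w₀ L) z (0, z.2) = 2 * coordE w₀ L z := by
  have hq : ContDiffAt ℝ ∞ (coordE w₀ L) z := by
    have := hL.contDiffAt_coordE hs ((ch w₀).map_target hz)
    rwa [(ch w₀).right_inv hz] at this
  have hc : HasDerivAt (fun t : ℝ => (z.1, t • z.2)) ((0 : E), z.2) 1 := by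
    have := (hasDerivAt_const (1 : ℝ) z.1).prodMk ((hasDerivAt_id (1 : ℝ)).smul_const z.2)
    simpa using this
  have hq' : HasFDerivAt (coordE w₀ L) (fderiv ℝ (coordE w₀ L) z) (z.1, (1 : ℝ) • z.2) := by
    rw [one_smul]
    exact (differentiableAt_of_contDiffAt hq).hasFDerivAt
  have h1 := hq'.comp_hasDerivAt (1 : ℝ) hc
  have h2 : HasDerivAt (fun t : ℝ => t ^ 2 * coordE w₀ L z) (2 * coordE w₀ L z) 1 := by
    simpa using (hasDerivAt_pow 2 (1 : ℝ)).mul_const (coordE w₀ L z)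
  refine h1.unique (h2.congr_of_eventuallyEq ?_)
  filter_upwards [lt_mem_nhds (zero_lt_one' ℝ)] with t ht using hL.coordE_smul hz ht

theorem eventually_target_slit {w : TM E M} (hw : w ∈ slit E M) :
    ∀ᶠ z in 𝓝 (ch w w), z ∈ (ch w).target ∧ (ch w).symm z ∈ slit E M :=
  (eventually_target (mem_ch_source_self w)).and (eventually_slit hw)

theorem IsFinsler.contDiffAt_coordE_of_target {L : TM E M → ℝ} (hL : IsFinsler L) {w₀ : TM E M}
    {z : E × E} (hz : z ∈ (ch w₀).target) (hs : (ch w₀).symm z ∈ slit E M) :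
    ContDiffAt ℝ ∞ (coordE w₀ L) z := by
  have := hL.contDiffAt_coordE hs ((ch w₀).map_target hz)
  rwa [(ch w₀).right_inv hz] at this

theorem IsFinsler.eventually_euler {L : TM E M → ℝ} (hL : IsFinsler L) {w₀ : TM E M} {z : E × E}
    (hz : z ∈ (ch w₀).target) (hs : (ch w₀).symm z ∈ slit E M) :
    (fun y => fderiv ℝ (coordE w₀ L) y (0, y.2)) =ᶠ[𝓝 z] fun y => 2 * coordE w₀ L y := by
  have h2 : ∀ᶠ y in 𝓝 z, y.2 ≠ 0 :=
    continuousAt_snd.eventually_ne ((ch_symm_mem_slit hz).1 hs)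
  filter_upwards [(isOpen_ch_target w₀).mem_nhds hz, h2] with y hy1 hy2
  exact hL.euler hy1 ((ch_symm_mem_slit hy1).2 hy2)

theorem hasFDerivAt_zero_snd (z : E × E) : HasFDerivAt (fun y : E × E => ((0 : E), y.2))
    ((0 : E × E →L[ℝ] E).prod (ContinuousLinearMap.snd ℝ E E)) z :=
  (hasFDerivAt_const _ _).prodMk hasFDerivAt_snd

/-- Euler's relation differentiated once more, in the direction `x`. -/
theorem IsFinsler.hess_eta {L : TM E M → ℝ} (hL : IsFinsler L) {w₀ : TM E M} {z : E × E}
    (hz : z ∈ (ch w₀).target) (hs : (ch w₀).symm z ∈ slit E M) (x : E × E) :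
    hess (coordE w₀ L) z x (0, z.2) =
      2 * fderiv ℝ (coordE w₀ L) z x - fderiv ℝ (coordE w₀ L) z (0, x.2) := by
  have hq := hL.contDiffAt_coordE_of_target hz hs
  have h1 := fderiv_fderiv_apply hq (hasFDerivAt_zero_snd z).differentiableAt x
  rw [(hL.eventually_euler hz hs).fderiv_eq, (hasFDerivAt_zero_snd z).fderiv,
    fderiv_const_mul (differentiableAt_of_contDiffAt hq)] at h1
  simp only [smul_apply, smul_eq_mul, ContinuousLinearMap.prod_apply,
    zero_apply, ContinuousLinearMap.coe_snd'] at h1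
  linarith

/-! ### Linear connections in coordinates -/

theorem PiField.DiffAt.add {Y Z : PiField E M} {w : TM E M} (hY : Y.DiffAt w)
    (hZ : Z.DiffAt w) : PiField.DiffAt (fun z => Y z + Z z) w := by
  refine PiField.diffAt_iff.2 (((PiField.diffAt_iff.1 hY).add
    (PiField.diffAt_iff.1 hZ)).congr_of_eventuallyEq (Filter.Eventually.of_forall fun z => ?_))
  exact map_add (dbase w ((ch w).symm z)) _ _

theorem PiField.DiffAt.smul {f : TM E M → ℝ} {Y : PiField E M} {w : TM E M}
    (hf : MDifferentiableAt (𝓘(ℝ, E).tangent) 𝓘(ℝ, ℝ) f w) (hY : Y.DiffAt w) :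
    PiField.DiffAt (fun z => f z • Y z) w := by
  refine PiField.diffAt_iff.2
    ((((mdifferentiableAt_iff_coord (mem_ch_source_self w)).1 hf).smul
    (PiField.diffAt_iff.1 hY)).congr_of_eventuallyEq (Filter.Eventually.of_forall fun z => ?_))
  exact map_smul (dbase w ((ch w).symm z)) _ _

theorem dFun_of_eventuallyEq_const {f : TM E M → ℝ} {w : TM E M} {c : ℝ}
    (h : f =ᶠ[𝓝 w] fun _ => c) :
    MDifferentiableAt (𝓘(ℝ, E).tangent) 𝓘(ℝ, ℝ) f w ∧ dFun f w = 0 := by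
  have h1 : HasMFDerivAt (𝓘(ℝ, E).tangent) 𝓘(ℝ, ℝ) f w 0 :=
    (hasMFDerivAt_const c w).congr_of_eventuallyEq h
  refine ⟨h1.mdifferentiableAt, ?_⟩
  ext x
  exact congrArg (fun A : TTan w →L[ℝ] ℝ => A x) h1.mfderiv

namespace PiConnection

variable (D : PiConnection E M)

theorem congr_of_eventuallyEq {w : TM E M} (hw : w ∈ slit E M) {Y Z : PiField E M}
    (hY : Y.DiffAt w) (hZ : Z.DiffAt w) (h : ∀ᶠ z in 𝓝 w, Y z = Z z) : D.D Y w = D.D Z w := by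
  classical
  -- The indicator of the agreement set serves as a cut-off: `f • Y = f • Z` holds everywhere, while
  -- `f` is constantly 1 near `w`, so the Leibniz rule returns `D Y` and `D Z` at `w`.
  let f : TM E M → ℝ := fun z => if Y z = Z z then 1 else 0
  have hf : f =ᶠ[𝓝 w] fun _ => 1 := by
    filter_upwards [h] with z hz
    exact if_pos hz
  have hf' := dFun_of_eventuallyEq_const hf
  have hfw : f w = 1 := hf.self_of_nhds
  have h1 := D.leibniz w hw f Y hf'.1 hY
  have h2 := D.leibniz w hw f Z hf'.1 hZ
  have h3 : (fun z => f z • Y z) = fun z => f z • Z z := by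
    ext1 z
    by_cases hz : Y z = Z z
    · rw [hz]
    · have : f z = 0 := if_neg hz
      rw [this, zero_smul, zero_smul]
  rw [h3, h2, hfw, hf'.2] at h1
  ext x
  have := congrArg (fun A : TTan w →L[ℝ] PiFib w => A x) h1
  simpa using this.symm

theorem const_smul {w : TM E M} (hw : w ∈ slit E M) {Y : PiField E M} (hY : Y.DiffAt w) (c : ℝ) :
    D.D (fun z => c • Y z) w = c • D.D Y w := by
  have hf := dFun_of_eventuallyEq_const (f := fun _ : TM E M => c) (w := w) (c := c) (by rfl)
  rw [D.leibniz w hw (fun _ => c) Y hf.1 hY, hf.2]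
  ext x
  simp

/-- The Christoffel symbols of `D` in the chart around `w`, at the point `w`. -/
def chr (w : TM E M) (a : E) : E × E →L[ℝ] E := D.D (constP w a) w

theorem chr_add {w : TM E M} (hw : w ∈ slit E M) (a b : E) :
    D.chr w (a + b) = D.chr w a + D.chr w b := by
  have h : constP w (a + b) = fun z => constP w a z + constP w b z := by
    ext1 z
    exact map_add (dbase w z).inverse a b
  unfold chr
  rw [h]
  exact D.add w hw _ _ (diffAt_constP w a) (diffAt_constP w b)

theorem chr_smul {w : TM E M} (hw : w ∈ slit E M) (c : ℝ) (a : E) :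
    D.chr w (c • a) = c • D.chr w a := by
  have h : constP w (c • a) = fun z => c • constP w a z := by
    ext1 z
    exact map_smul (dbase w z).inverse c a
  unfold chr
  rw [h]
  exact D.const_smul hw (diffAt_constP w a) c

/-- `chr` as a linear map. -/
def chrₗ {w : TM E M} (hw : w ∈ slit E M) : E →ₗ[ℝ] E × E →L[ℝ] E where
  toFun := D.chr w
  map_add' := D.chr_add hw
  map_smul' := D.chr_smul hw

theorem sum {w : TM E M} (hw : w ∈ slit E M) {ι : Type*} (s : Finset ι)
    (f : ι → TM E M → ℝ) (Y : ι → PiField E M)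
    (hf : ∀ i, MDifferentiableAt (𝓘(ℝ, E).tangent) 𝓘(ℝ, ℝ) (f i) w) (hY : ∀ i, (Y i).DiffAt w) :
    PiField.DiffAt (fun z => ∑ i ∈ s, f i z • Y i z) w ∧
    ∀ x, D.D (fun z => ∑ i ∈ s, f i z • Y i z) w x =
      ∑ i ∈ s, (f i w • D.D (Y i) w x + dFun (f i) w x • Y i w) := by
  classical
  induction s using Finset.induction_on with
  | empty =>
    -- The connection axioms do not mention the zero section; it is reached as `0 • eta`, where
    -- `eta` is just a differentiable section at hand.
    have h0 : (fun z : TM E M => ∑ i ∈ (∅ : Finset ι), f i z • Y i z) =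
        fun z => (0 : ℝ) • (eta z : PiFib z) := by
      ext1 z
      simp
    rw [h0]
    refine ⟨PiField.DiffAt.smul mdifferentiableAt_const (diffAt_eta w), fun x => ?_⟩
    rw [D.const_smul hw (diffAt_eta w)]
    simp
  | insert i s hi ih =>
    have h1 : (fun z : TM E M => ∑ j ∈ insert i s, f j z • Y j z) =
        fun z => f i z • Y i z + ∑ j ∈ s, f j z • Y j z := by
      ext1 z
      rw [Finset.sum_insert hi]
    rw [h1]
    have h2 := PiField.DiffAt.smul (hf i) (hY i)
    refine ⟨h2.add ih.1, fun x => ?_⟩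
    rw [D.add w hw _ _ h2 ih.1, D.leibniz w hw _ _ (hf i) (hY i), Finset.sum_insert hi, ← ih.2 x]
    simp

/-- Expand `Y` near `w` in a finite frame with constant coordinates and apply the Leibniz rule term
by term. Finite dimension enters through the choice of this frame. -/
theorem D_eq [FiniteDimensional ℝ E] {w : TM E M} (hw : w ∈ slit E M) {Y : PiField E M}
    (hY : Y.DiffAt w) (x : E × E) :
    D.D Y w x = fderiv ℝ (coordP w Y) (ch w w) x + D.chr w (Y w) x := by
  let b := Module.finBasis ℝ E
  let l : ∀ i, E →L[ℝ] ℝ := fun i => LinearMap.toContinuousLinearMap (b.coord i)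
  let f : Fin (Module.finrank ℝ E) → TM E M → ℝ := fun i z => l i (dbase w z (Y z))
  have hYd := PiField.diffAt_iff.1 hY
  have hfd : ∀ i, HasFDerivAt (coordF w (f i))
      ((l i).comp (fderiv ℝ (coordP w Y) (ch w w))) (ch w w) := fun i =>
    (l i).hasFDerivAt.comp (ch w w) hYd.hasFDerivAt
  have hf : ∀ i, MDifferentiableAt (𝓘(ℝ, E).tangent) 𝓘(ℝ, ℝ) (f i) w := fun i =>
    (mdifferentiableAt_iff_coord (mem_ch_source_self w)).2 (hfd i).differentiableAt
  obtain ⟨h1, h2⟩ := D.sum hw Finset.univ f (fun i => constP w (b i)) hf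
    (fun i => diffAt_constP w (b i))
  have hb : ∀ v : E, ∑ i, l i v • b i = v := fun v => b.sum_repr v
  have h3 : ∀ᶠ z in 𝓝 w, Y z = ∑ i, f i z • constP w (b i) z := by
    filter_upwards [eventually_mem_source w] with z hz
    have h4 : (dbase w z).inverse (dbase w z (Y z)) = Y z :=
      (isInvertible_dbase hz).inverse_apply_self _
    have h5 : (dbase w z).inverse (∑ i, l i (dbase w z (Y z)) • b i) =
        ∑ i, f i z • constP w (b i) z := by
      rw [map_sum]
      refine Finset.sum_congr rfl fun i _ => ?_
      exact map_smul (dbase w z).inverse _ _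
    rw [← h5, hb, h4]
  rw [D.congr_of_eventuallyEq hw hY h1 h3, h2 x, Finset.sum_add_distrib, add_comm]
  congr 1
  · refine Eq.trans (Finset.sum_congr rfl fun i _ => ?_) (hb _)
    rw [dFun_self (hfd i).differentiableAt x, (hfd i).fderiv]
    exact congrArg (fun v : E => l i (fderiv ℝ (coordP w Y) (ch w w) x) • v)
      (constP_self w (b i))
  · have h6 : ∀ i, f i w = l i (Y w) := fun i => by
      simp only [f, dbase_self]
      rfl
    have h7 : D.chrₗ hw (∑ i, l i (Y w) • b i) x = D.chr w (Y w) x :=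
      congrArg (fun v : E => D.chr w v x) (hb (Y w))
    rw [← h7, map_sum, sum_apply]
    refine Finset.sum_congr rfl fun i _ => ?_
    rw [h6, map_smul]
    rfl

theorem K_eq [FiniteDimensional ℝ E] {w : TM E M} (hw : w ∈ slit E M) (x : E × E) :
    D.K w x = x.2 + D.chr w (ch w w).2 x := by
  have h1 : coordP w (eta : PiField E M) =ᶠ[𝓝 (ch w w)] Prod.snd := by
    filter_upwards [eventually_target (mem_ch_source_self w)] with z hz using coordP_eta hz
  have h2 := D.D_eq hw (diffAt_eta w) x
  rw [h1.fderiv_eq, fderiv_snd] at h2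
  rw [ch_self_snd]
  exact h2

theorem D_rhoField_constV {w : TM E M} (hw : w ∈ slit E M) (x : E × E) :
    D.D (rhoField (constV w x)) w = D.chr w x.1 := by
  have h0 : ∀ z ∈ (ch w).target, coordP w (rhoField (constV w x)) z = x.1 := fun z hz => by
    rw [coordP_rhoField _ hz, coordV_constV x hz]
  have h1 : (rhoField (constV w x)).DiffAt w := by
    refine PiField.diffAt_iff.2 ((differentiableAt_const x.1).congr_of_eventuallyEq ?_)
    filter_upwards [eventually_target (mem_ch_source_self w)] with z hz using h0 z hz
  refine D.congr_of_eventuallyEq hw h1 (diffAt_constP w x.1) ?_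
  filter_upwards [eventually_mem_source w] with z hz
  refine (((isInvertible_dbase hz).inverse_apply_eq).2 ?_).symm
  have h2 := h0 _ ((ch w).map_source hz)
  unfold coordP at h2
  rw [(ch w).left_inv hz] at h2
  exact h2.symm

theorem bracket_constV (w : TM E M) (x y : E × E) :
    bracket (constV w x) (constV w y) w = 0 := by
  rw [bracket_self]
  have h : ∀ c : E × E, coordV w (constV w c) =ᶠ[𝓝 (ch w w)] fun _ => c := fun c => by
    filter_upwards [eventually_target (mem_ch_source_self w)] with z hz using coordV_constV c hz
  rw [(h x).lieBracket_vectorField_eq (h y)]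
  simp [lieBracket]
  rfl

/-- Fields with constant coordinates commute, so the bracket term drops out. The torsion conditions
of the Cartan connection are tested on such fields. -/
theorem torsion_constV {w : TM E M} (hw : w ∈ slit E M) (x y : E × E) :
    D.torsion (constV w x) (constV w y) w = D.chr w y.1 x - D.chr w x.1 y := by
  unfold torsion
  rw [bracket_constV, map_zero, D.D_rhoField_constV hw, D.D_rhoField_constV hw]
  rw [sub_zero]
  exact congrArg₂ (fun a b : E × E => (D.chr w y.1 a - D.chr w x.1 b : E))
    (constV_self w x) (constV_self w y)

end PiConnection

/-! ### The Finsler metric at a point -/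

/-- The Finsler metric at `w`, as a continuous bilinear form on the model space. -/
def vmetric (L : TM E M → ℝ) (w : TM E M) : E →L[ℝ] E →L[ℝ] ℝ :=
  (hess (coordE w L) (ch w w)).bilinearComp (ContinuousLinearMap.inr ℝ E E)
    (ContinuousLinearMap.inr ℝ E E)

theorem vmetric_apply (L : TM E M → ℝ) (w : TM E M) (a b : E) :
    vmetric L w a b = hess (coordE w L) (ch w w) (0, a) (0, b) := rfl

theorem metric_self {L : TM E M → ℝ} (hL : IsFinsler L) {w : TM E M} (hw : w ∈ slit E M)
    (a b : E) : metric L w a b = vmetric L w a b := by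
  have h := metric_eq hL hw (mem_ch_source_self w) a b
  rw [dbase_self] at h
  exact h

theorem IsFinsler.contDiffAt_self {L : TM E M → ℝ} (hL : IsFinsler L) {w : TM E M}
    (hw : w ∈ slit E M) : ContDiffAt ℝ ∞ (coordE w L) (ch w w) :=
  hL.contDiffAt_coordE hw (mem_ch_source_self w)

theorem vmetric_comm {L : TM E M → ℝ} (hL : IsFinsler L) {w : TM E M} (hw : w ∈ slit E M)
    (a b : E) : vmetric L w a b = vmetric L w b a :=
  hess_comm ((hL.contDiffAt_self hw).of_le two_le_infty) _ _

theorem vmetric_pos {L : TM E M → ℝ} (hL : IsFinsler L) {w : TM E M} (hw : w ∈ slit E M)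
    {a : E} (ha : a ≠ 0) : 0 < vmetric L w a a := by
  rw [← metric_self hL hw]
  exact hL.posDef w hw a ha

theorem vmetric_self_nonneg {L : TM E M → ℝ} (hL : IsFinsler L) {w : TM E M} (hw : w ∈ slit E M)
    (a : E) : 0 ≤ vmetric L w a a := by
  by_cases ha : a = 0
  · simp [ha]
  · exact (vmetric_pos hL hw ha).le

theorem vmetric_ext {L : TM E M → ℝ} (hL : IsFinsler L) {w : TM E M} (hw : w ∈ slit E M)
    {a b : E} (h : ∀ c, vmetric L w a c = vmetric L w b c) : a = b := by
  by_contra hab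
  have h1 := vmetric_pos hL hw (sub_ne_zero.2 hab)
  rw [map_sub (vmetric L w) a b, sub_apply, h, sub_self] at h1
  exact lt_irrefl _ h1

theorem self_mem_target (w : TM E M) : ch w w ∈ (ch w).target :=
  (ch w).map_source (mem_ch_source_self w)

theorem symm_self_mem_slit {w : TM E M} (hw : w ∈ slit E M) : (ch w).symm (ch w w) ∈ slit E M := by
  rwa [(ch w).left_inv (mem_ch_source_self w)]

theorem hess_eta_self {L : TM E M → ℝ} (hL : IsFinsler L) {w : TM E M} (hw : w ∈ slit E M)
    (x : E × E) : hess (coordE w L) (ch w w) x (0, (ch w w).2) =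
      2 * fderiv ℝ (coordE w L) (ch w w) x - fderiv ℝ (coordE w L) (ch w w) (0, x.2) :=
  hL.hess_eta (self_mem_target w) (symm_self_mem_slit hw) x

theorem vmetric_eta {L : TM E M → ℝ} (hL : IsFinsler L) {w : TM E M} (hw : w ∈ slit E M)
    (a : E) : vmetric L w (ch w w).2 a = fderiv ℝ (coordE w L) (ch w w) (0, a) := by
  rw [vmetric_comm hL hw, vmetric_apply, hess_eta_self hL hw]
  ring

theorem vmetric_eta_eta {L : TM E M → ℝ} (hL : IsFinsler L) {w : TM E M} (hw : w ∈ slit E M) :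
    vmetric L w (ch w w).2 (ch w w).2 = 2 * energy L w := by
  rw [vmetric_eta hL hw, hL.euler (self_mem_target w) (symm_self_mem_slit hw)]
  unfold coordE coordF
  rw [(ch w).left_inv (mem_ch_source_self w)]

/-! ### The Cartan connection at a point -/

theorem hasFDerivAt_zero_coordP {w : TM E M} {Y : PiField E M} (hY : Y.DiffAt w) :
    HasFDerivAt (fun z => ((0 : E), coordP w Y z))
      ((0 : E × E →L[ℝ] E).prod (fderiv ℝ (coordP w Y) (ch w w))) (ch w w) :=
  (hasFDerivAt_const _ _).prodMk (PiField.diffAt_iff.1 hY).hasFDerivAt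

theorem coordF_metric_eventuallyEq {L : TM E M → ℝ} (hL : IsFinsler L) {w : TM E M}
    (hw : w ∈ slit E M) (Y Z : PiField E M) :
    coordF w (fun u => metric L u (Y u) (Z u)) =ᶠ[𝓝 (ch w w)]
      fun z => hess (coordE w L) z (0, coordP w Y z) (0, coordP w Z z) := by
  filter_upwards [eventually_target_slit hw] with z hz using coordF_metric hL hz.1 hz.2 Y Z

theorem differentiableAt_coordF_metric {L : TM E M → ℝ} (hL : IsFinsler L) {w : TM E M}
    (hw : w ∈ slit E M) {Y Z : PiField E M} (hY : Y.DiffAt w) (hZ : Z.DiffAt w) :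
    DifferentiableAt ℝ (coordF w (fun u => metric L u (Y u) (Z u))) (ch w w) := by
  refine DifferentiableAt.congr_of_eventuallyEq ?_ (coordF_metric_eventuallyEq hL hw Y Z)
  have h := differentiableAt_of_contDiffAt (contDiffAt_fderiv (contDiffAt_fderiv
    (hL.contDiffAt_self hw)))
  exact (h.clm_apply (hasFDerivAt_zero_coordP hY).differentiableAt).clm_apply
    (hasFDerivAt_zero_coordP hZ).differentiableAt

section Cartan

variable {L : TM E M → ℝ} {D : PiConnection E M} {w : TM E M}

theorem IsCartan.fderiv_metric (hD : IsCartan L D) (hL : IsFinsler L) (hw : w ∈ slit E M)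
    {Y Z : PiField E M} (hY : Y.DiffAt w) (hZ : Z.DiffAt w) (x : E × E) :
    fderiv ℝ (coordF w (fun u => metric L u (Y u) (Z u))) (ch w w) x =
      vmetric L w (D.D Y w x) (Z w) + vmetric L w (Y w) (D.D Z w x) := by
  rw [← dFun_self (differentiableAt_coordF_metric hL hw hY hZ) x]
  refine (hD.metric_compatible w hw Y Z hY hZ x).trans ?_
  exact congrArg₂ (· + ·) (metric_self hL hw _ _) (metric_self hL hw _ _)

theorem coordP_constP_eventuallyEq (w : TM E M) (a : E) :
    coordP w (constP w a) =ᶠ[𝓝 (ch w w)] fun _ => a := by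
  filter_upwards [eventually_target (mem_ch_source_self w)] with z hz using coordP_constP a hz

theorem coordP_eta_eventuallyEq (w : TM E M) :
    coordP w (eta : PiField E M) =ᶠ[𝓝 (ch w w)] Prod.snd := by
  filter_upwards [eventually_target (mem_ch_source_self w)] with z hz using coordP_eta hz

theorem IsCartan.third_eq (hD : IsCartan L D) (hL : IsFinsler L) (hw : w ∈ slit E M)
    (x : E × E) (a b : E) :
    third (coordE w L) (ch w w) x (0, a) (0, b) =
      vmetric L w (D.chr w a x) b + vmetric L w a (D.chr w b x) := by
  have h := hD.fderiv_metric hL hw (diffAt_constP w a) (diffAt_constP w b) x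
  have h1 : coordF w (fun u => metric L u (constP w a u) (constP w b u)) =ᶠ[𝓝 (ch w w)]
      fun z => hess (coordE w L) z (0, a) (0, b) := by
    filter_upwards [coordF_metric_eventuallyEq hL hw (constP w a) (constP w b),
      coordP_constP_eventuallyEq w a, coordP_constP_eventuallyEq w b] with z h1 h2 h3
    rw [h1, h2, h3]
  rw [h1.fderiv_eq, fderiv_hess_apply (hL.contDiffAt_self hw) (differentiableAt_const _)
    (differentiableAt_const _)] at h
  simp only [fderiv_fun_const, Pi.zero_apply, zero_apply, map_zero, add_zero] at h
  rw [h]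
  exact congrArg₂ (fun a' b' => vmetric L w (D.chr w a x) b' + vmetric L w a' (D.chr w b x))
    (constP_self w a) (constP_self w b)

/-- By regularity `(a, 0)` splits into a vertical and a horizontal part; the vertical part has no
base component, so the horizontal one lies over `a`. -/
theorem IsCartan.exists_horizontal (hD : IsCartan L D) (hw : w ∈ slit E M) (a : E) :
    ∃ a' : E, D.K w ((a, a') : E × E) = 0 := by
  have h := (hD.regular w hw).sup_eq_top
  let u : TTan w := ((a, 0) : E × E)
  have h1 : u ∈ (⊤ : Submodule ℝ (TTan w)) := Submodule.mem_top
  rw [← h] at h1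
  obtain ⟨y, hy, z, hz, hyz⟩ := Submodule.mem_sup.1 h1
  have hy' : (y : E × E).1 = 0 := (rho_self w y).symm.trans hy
  have h2 : (y : E × E).1 + (z : E × E).1 = a := congrArg (Prod.fst : E × E → E) hyz
  rw [hy', zero_add] at h2
  refine ⟨(z : E × E).2, ?_⟩
  have h3 : ((a, (z : E × E).2) : E × E) = z := Prod.ext h2.symm rfl
  rw [h3]
  exact hz

theorem IsCartan.vmetric_chr_vertical_comm (hD : IsCartan L D) (hL : IsFinsler L)
    (hw : w ∈ slit E M) (a b c : E) :
    vmetric L w (D.chr w a (0, c)) b = vmetric L w (D.chr w b (0, c)) a := by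
  obtain ⟨a', ha⟩ := hD.exists_horizontal hw a
  obtain ⟨b', hb⟩ := hD.exists_horizontal hw b
  have hself := constV_self w
  have h0 : D.chr w (0 : E) = 0 := by
    have := D.chr_smul hw 0 (0 : E)
    rwa [zero_smul, zero_smul] at this
  -- A vertical field has ρX = 0, so only one of the two symbols in the torsion survives.
  have ht : ∀ e e' : E, D.torsion (constV w (0, c)) (constV w (e, e')) w = D.chr w e (0, c) :=
    fun e e' => by
      rw [D.torsion_constV hw]
      simp only [h0]
      exact sub_zero _
  have hr : ∀ e : E × E, rho w (constV w e w) = e.1 := fun e => by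
    rw [← rho_self w e]
    exact congrArg (rho w) (hself e)
  have h := hD.hhv_torsion w hw (constV w (0, c)) (constV w (a, a')) (constV w (b, b'))
    (diffAt_constV _ _) (diffAt_constV _ _) (diffAt_constV _ _) (hr _)
    ((congrArg (D.K w) (hself _)).trans ha) ((congrArg (D.K w) (hself _)).trans hb)
  rw [ht, ht, hr, hr] at h
  exact (metric_self hL hw _ _).symm.trans (h.trans (metric_self hL hw _ _))

/-- Metricity writes the third derivative as a sum of two terms, and the (h)hv-torsion condition
makes them equal: the vertical symbols are the Cartan tensor. -/
theorem IsCartan.vmetric_chr_vertical (hD : IsCartan L D) (hL : IsFinsler L)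
    (hw : w ∈ slit E M) (a b c : E) :
    2 * vmetric L w (D.chr w a (0, c)) b = third (coordE w L) (ch w w) (0, c) (0, a) (0, b) := by
  rw [hD.third_eq hL hw, vmetric_comm hL hw a, hD.vmetric_chr_vertical_comm hL hw b a]
  ring

theorem IsCartan.chr_symm (hD : IsCartan L D) (hw : w ∈ slit E M) {x y : E × E}
    (hx : D.K w x = 0) (hy : D.K w y = 0) : D.chr w y.1 x = D.chr w x.1 y := by
  have h := hD.hh_torsion w hw (constV w x) (constV w y) (diffAt_constV _ _) (diffAt_constV _ _)
    ((congrArg (D.K w) (constV_self w x)).trans hx)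
    ((congrArg (D.K w) (constV_self w y)).trans hy)
  rw [D.torsion_constV hw] at h
  exact sub_eq_zero.1 h

/-- The horizontal lift of y satisfies the spray equation. Write c for the constant section and `(c,
c')` for its horizontal lift. Differentiating g(η, c) = dE(0, c) along the lift of y leaves g(η,
∇c); the vanishing (h)h-torsion swaps the arguments of the symbol, and K(c, c') = 0 turns the result
into -dE(0, c'). Differentiating g(η, η) = 2E along `(c, c')` gives dE(c, 0) = -dE(0, c'). -/
theorem IsCartan.hess_horizontal [FiniteDimensional ℝ E] (hD : IsCartan L D) (hL : IsFinsler L)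
    (hw : w ∈ slit E M) {s : E} (hs : D.K w (((ch w w).2, s) : E × E) = 0) (c : E) :
    hess (coordE w L) (ch w w) ((ch w w).2, s) (0, c) =
      fderiv ℝ (coordE w L) (ch w w) (c, 0) := by
  obtain ⟨c', hc⟩ := hD.exists_horizontal hw c
  have hq := hL.contDiffAt_self hw
  have heta : (eta w : E) = (ch w w).2 := (ch_self_snd w).symm
  have h1 : coordF w (fun u => metric L u (eta u) (constP w c u)) =ᶠ[𝓝 (ch w w)]
      fun z => fderiv ℝ (coordE w L) z (0, c) := by
    filter_upwards [coordF_metric_eventuallyEq hL hw eta (constP w c), eventually_target_slit hw,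
      coordP_constP_eventuallyEq w c, coordP_eta_eventuallyEq w] with z h1 h2 h3 h4
    rw [h1, h3, h4, hess_comm ((hL.contDiffAt_coordE_of_target h2.1 h2.2).of_le two_le_infty),
      hL.hess_eta h2.1 h2.2]
    ring
  have h2 : coordF w (fun u => metric L u (eta u) (eta u)) =ᶠ[𝓝 (ch w w)]
      fun z => 2 * coordE w L z := by
    filter_upwards [coordF_metric_eventuallyEq hL hw eta eta, eventually_target_slit hw,
      coordP_eta_eventuallyEq w] with z h1 h2 h4
    rw [h1, h4, hL.hess_eta h2.1 h2.2, hL.euler h2.1 h2.2]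
    ring
  have h3 := hD.fderiv_metric hL hw (diffAt_eta w) (diffAt_constP w c) ((ch w w).2, s)
  have h4 := hD.fderiv_metric hL hw (diffAt_eta w) (diffAt_eta w) (c, c')
  have hKs : D.D eta w (((ch w w).2, s) : E × E) = (0 : E) := hs
  have hKc : D.D eta w ((c, c') : E × E) = (0 : E) := hc
  have hcc : (constP w c w : E) = c := constP_self w c
  have hDc : (D.D (constP w c) w (((ch w w).2, s) : E × E) : E) =
    D.chr w c ((ch w w).2, s) := rfl
  rw [h1.fderiv_eq, fderiv_fderiv_apply hq (differentiableAt_const _), hKs, hcc, hDc, heta,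
    show c = ((c, c') : E × E).1 from rfl, hD.chr_symm hw hs hc] at h3
  rw [h2.fderiv_eq, fderiv_const_mul (differentiableAt_of_contDiffAt hq), hKc, heta] at h4
  have hK := D.K_eq hw (c, c')
  rw [hc] at hK
  have hK' : D.chr w (ch w w).2 (c, c') = -c' := (neg_eq_of_add_eq_zero_right hK.symm).symm
  have h5 : fderiv ℝ (coordE w L) (ch w w) (c, c') =
      fderiv ℝ (coordE w L) (ch w w) (c, 0) + fderiv ℝ (coordE w L) (ch w w) (0, c') := by
    rw [← map_add]
    simp
  simp only [fderiv_fun_const, Pi.zero_apply, zero_apply, map_zero, add_zero, zero_add, hK',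
    vmetric_eta hL hw, smul_apply, smul_eq_mul] at h3 h4
  have h6 : ((0 : E), -c') = -(0, c') := by simp
  rw [h6, map_neg] at h3
  rw [Prod.mk_zero_zero, map_zero] at h4
  linarith

end Cartan

/-! ### The canonical spray at a point -/

section Spray

variable {L : TM E M → ℝ} {G : VField E M} {w : TM E M}

theorem dJ_apply_eq (hL : IsFinsler L) {z : E × E}
    (hz : z ∈ (ch w).target) (hs : (ch w).symm z ∈ slit E M) (X : VField E M) :
    coordF w (fun u => dJ (energy L) u (X u)) z =
      fderiv ℝ (coordE w L) z (0, (coordV w X z).1) := by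
  have hsrc := (ch w).map_target hz
  have hd : MDifferentiableAt (𝓘(ℝ, E).tangent) 𝓘(ℝ, ℝ) (energy L) ((ch w).symm z) :=
    (mdifferentiableAt_iff_coord hsrc).2
      (differentiableAt_of_contDiffAt (hL.contDiffAt_coordE hs hsrc))
  have h := dFun_eq hsrc hd (JField X ((ch w).symm z))
  rw [(ch w).right_inv hz] at h
  rw [← coordV_JField X hz]
  exact h

theorem dJ_self (hL : IsFinsler L) (hw : w ∈ slit E M) (x : E × E) :
    dJ (energy L) w x = fderiv ℝ (coordE w L) (ch w w) (0, x.1) := by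
  have h := dJ_apply_eq hL (self_mem_target w) (symm_self_mem_slit hw) (constV w x)
  rw [coordV_constV x (self_mem_target w)] at h
  unfold coordF at h
  rw [(ch w).left_inv (mem_ch_source_self w)] at h
  exact (congrArg (dJ (energy L) w) (constV_self w x)).symm.trans h

theorem coordV_constV_eventuallyEq (w : TM E M) (c : E × E) :
    coordV w (constV w c) =ᶠ[𝓝 (ch w w)] fun _ => c := by
  filter_upwards [eventually_target (mem_ch_source_self w)] with z hz using coordV_constV c hz

/-- The defining equation is tested on a field with constant coordinates: the derivative of `G`
occurring in X(θ(G)) cancels the one in θ([G, X]), leaving only the value of `G` at `w`. -/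
theorem IsCanonicalSpray.hess_eq (hG : IsCanonicalSpray L G) (hL : IsFinsler L)
    (hw : w ∈ slit E M) (x : E × E) :
    hess (coordE w L) (ch w w) (G w) (0, x.1) -
      hess (coordE w L) (ch w w) x (0, (G w : E × E).1) =
        -fderiv ℝ (coordE w L) (ch w w) x := by
  have hq := hL.contDiffAt_self hw
  have hGd : DifferentiableAt ℝ (coordV w G) (ch w w) :=
    differentiableAt_of_contDiffAt (hG.smooth.contDiffAt_coordV hw)
  have hGw : coordV w G (ch w w) = G w := coordV_self w G
  have hG1 : HasFDerivAt (fun z => ((0 : E), (coordV w G z).1))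
      ((0 : E × E →L[ℝ] E).prod ((ContinuousLinearMap.fst ℝ E E).comp
        (fderiv ℝ (coordV w G) (ch w w)))) (ch w w) :=
    (hasFDerivAt_const _ _).prodMk hGd.hasFDerivAt.fst
  have h := hG.eq w hw (constV w x) (diffAt_constV w x)
  have h1 : coordF w (fun u => dJ (energy L) u (constV w x u)) =ᶠ[𝓝 (ch w w)]
      fun z => fderiv ℝ (coordE w L) z (0, x.1) := by
    filter_upwards [eventually_target_slit hw, coordV_constV_eventuallyEq w x] with z hz hx
    rw [dJ_apply_eq hL hz.1 hz.2, hx]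
  have h2 : coordF w (fun u => dJ (energy L) u (G u)) =ᶠ[𝓝 (ch w w)]
      fun z => fderiv ℝ (coordE w L) z (0, (coordV w G z).1) := by
    filter_upwards [eventually_target_slit hw] with z hz
    rw [dJ_apply_eq hL hz.1 hz.2]
  have hd := differentiableAt_of_contDiffAt (contDiffAt_fderiv hq)
  have h1d := (hd.clm_apply (differentiableAt_const ((0 : E), x.1))).congr_of_eventuallyEq h1
  have h2d := (hd.clm_apply hG1.differentiableAt).congr_of_eventuallyEq h2
  have e1 : ∀ y : E × E, dFun (fun u => dJ (energy L) u (constV w x u)) w y =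
      hess (coordE w L) (ch w w) y (0, x.1) := fun y => by
    rw [dFun_self h1d y, h1.fderiv_eq, fderiv_fderiv_apply hq (differentiableAt_const _)]
    simp
  have e2 : dFun (fun u => dJ (energy L) u (G u)) w x =
      hess (coordE w L) (ch w w) x (0, (G w : E × E).1) +
        fderiv ℝ (coordE w L) (ch w w) (0, (fderiv ℝ (coordV w G) (ch w w) x).1) := by
    rw [dFun_self h2d x, h2.fderiv_eq, fderiv_fderiv_apply hq hG1.differentiableAt, hG1.fderiv,
      hGw]
    rfl
  have e3 : bracket G (constV w x) w = -(fderiv ℝ (coordV w G) (ch w w) x) := by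
    rw [bracket_self, (Filter.EventuallyEq.refl _ _).lieBracket_vectorField_eq
      (coordV_constV_eventuallyEq w x)]
    simp [lieBracket]
    rfl
  have e4 : dJ (energy L) w (bracket G (constV w x) w) =
      -fderiv ℝ (coordE w L) (ch w w) (0, (fderiv ℝ (coordV w G) (ch w w) x).1) := by
    rw [e3]
    refine (dJ_self hL hw _).trans ?_
    have h0 : ∀ y : E × E, ((0 : E), (-y).1) = -(0, y.1) := fun y => by simp
    exact (congrArg (fderiv ℝ (coordE w L) (ch w w)) (h0 _)).trans (map_neg _ _)
  have e5 : dFun (energy L) w x = fderiv ℝ (coordE w L) (ch w w) x :=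
    dFun_self (differentiableAt_of_contDiffAt hq) x
  have hx : constV w x w = x := constV_self w x
  unfold dOne at h
  rw [e1 (G w), e4, hx, e2, e5] at h
  linarith

theorem IsCanonicalSpray.fst_eq (hG : IsCanonicalSpray L G) (hL : IsFinsler L)
    (hw : w ∈ slit E M) : (G w : E × E).1 = (ch w w).2 := by
  refine vmetric_ext hL hw fun d => ?_
  have h := hG.hess_eq hL hw (0, d)
  have h0 : ((0 : E), ((0 : E), d).1) = 0 := rfl
  rw [vmetric_eta hL hw, vmetric_comm hL hw, vmetric_apply]
  rw [h0, map_zero] at h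
  linarith

theorem IsCanonicalSpray.hess_vertical (hG : IsCanonicalSpray L G) (hL : IsFinsler L)
    (hw : w ∈ slit E M) (c : E) :
    hess (coordE w L) (ch w w) (G w) (0, c) = fderiv ℝ (coordE w L) (ch w w) (c, 0) := by
  have h := hG.hess_eq hL hw (c, 0)
  rw [hG.fst_eq hL hw, hess_eta_self hL hw] at h
  simp only [Prod.mk_zero_zero, map_zero] at h
  linarith

/-- Two solutions over y differ by a vertical vector that is g-orthogonal to everything. -/
theorem IsCanonicalSpray.eq_of_hess (hG : IsCanonicalSpray L G) (hL : IsFinsler L)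
    (hw : w ∈ slit E M) {s : E} (hs : ∀ c, hess (coordE w L) (ch w w) ((ch w w).2, s) (0, c) =
      fderiv ℝ (coordE w L) (ch w w) (c, 0)) : (G w : E × E) = ((ch w w).2, s) := by
  have h1 := hG.fst_eq hL hw
  refine Prod.ext h1 (vmetric_ext hL hw fun c => ?_)
  have h2 := (hG.hess_vertical hL hw c).trans (hs c).symm
  have h3 : ∀ t : E, (((ch w w).2, t) : E × E) = ((ch w w).2, 0) + (0, t) := fun t => by simp
  have h4 : (G w : E × E) = ((ch w w).2, (G w : E × E).2) := Prod.ext h1 rfl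
  rw [h4, h3, h3 s, map_add, map_add, add_apply, add_apply] at h2
  exact add_left_cancel h2

theorem IsCanonicalSpray.K_eq_zero [FiniteDimensional ℝ E] {D : PiConnection E M}
    (hG : IsCanonicalSpray L G) (hD : IsCartan L D) (hL : IsFinsler L) (hw : w ∈ slit E M) :
    D.K w (G w) = 0 := by
  obtain ⟨s, hs⟩ := hD.exists_horizontal hw (ch w w).2
  have h := hG.eq_of_hess hL hw (hD.hess_horizontal hL hw hs)
  exact (congrArg (D.K w) h).trans hs

end Spray

/-! ### Concurrent fields -/

/-- The square `p² = g(ζ, ζ)` of the length of a `π`-vector field. -/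
def sqLength (L : TM E M → ℝ) (ζ : PiField E M) (u : TM E M) : ℝ := metric L u (ζ u) (ζ u)

/-- The function `B = g(ζ, η)`. -/
def pairing (L : TM E M → ℝ) (ζ : PiField E M) (u : TM E M) : ℝ := metric L u (ζ u) (eta u)

section Concurrent

variable {L : TM E M → ℝ} {ζ : PiField E M} {w : TM E M}

theorem IsConcurrent.contDiffAt_coordP (hζ : IsConcurrent L ζ) (hw : w ∈ slit E M) :
    ContDiffAt ℝ ∞ (coordP w ζ) (ch w w) := hζ.1.contDiffAt_coordP hw

theorem IsConcurrent.diffAt (hζ : IsConcurrent L ζ) (hw : w ∈ slit E M) : ζ.DiffAt w :=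
  PiField.diffAt_iff.2 (differentiableAt_of_contDiffAt (hζ.contDiffAt_coordP hw))

theorem IsConcurrent.contDiffAt_sqLength (hζ : IsConcurrent L ζ) (hL : IsFinsler L)
    (hw : w ∈ slit E M) : ContDiffAt ℝ ∞ (coordF w (sqLength L ζ)) (ch w w) := by
  refine ContDiffAt.congr_of_eventuallyEq ?_ (coordF_metric_eventuallyEq hL hw ζ ζ)
  have h1 := contDiffAt_fderiv (contDiffAt_fderiv (hL.contDiffAt_self hw))
  have h2 : ContDiffAt ℝ ∞ (fun z => ((0 : E), coordP w ζ z)) (ch w w) :=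
    contDiffAt_const.prodMk (hζ.contDiffAt_coordP hw)
  exact (h1.clm_apply h2).clm_apply h2

theorem IsConcurrent.dFun_sqLength (hζ : IsConcurrent L ζ) (hL : IsFinsler L)
    (hw : w ∈ slit E M) (x : TTan w) :
    dFun (sqLength L ζ) w x = -2 * metric L w (rho w x) (ζ w) := by
  obtain ⟨D, hD, hDζ⟩ := hζ.2
  have h := hD.metric_compatible w hw ζ ζ (hζ.diffAt hw) (hζ.diffAt hw) x
  have h1 : D.D ζ w x = (-(rho w x : E) : E) :=
    congrArg (fun A : TTan w →L[ℝ] PiFib w => A x) (hDζ w hw)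
  have h2 : metric L w (rho w x) (ζ w) = vmetric L w (rho w x) (ζ w) := metric_self hL hw _ _
  refine (h.trans (congrArg₂ (· + ·) (metric_self hL hw _ _) (metric_self hL hw _ _))).trans ?_
  have h3 : ∀ r z : E, vmetric L w (-r) z + vmetric L w z (-r) = -2 * vmetric L w r z :=
    fun r z => by
      rw [vmetric_comm hL hw z, map_neg, neg_apply]
      ring
  rw [h1, h2]
  exact h3 _ _

/-- The formula is needed on a neighbourhood because it is differentiated again: metricity is
applied at each nearby point, and the result is read in the one chart around `w`. -/
theorem IsConcurrent.fderiv_sqLength (hζ : IsConcurrent L ζ) (hL : IsFinsler L)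
    (hw : w ∈ slit E M) : ∀ᶠ z in 𝓝 (ch w w), ∀ x : E × E,
      fderiv ℝ (coordF w (sqLength L ζ)) z x =
        -2 * hess (coordE w L) z (0, x.1) (0, coordP w ζ z) := by
  filter_upwards [eventually_target_slit hw,
    eventually_contDiffAt_two (hζ.contDiffAt_sqLength hL hw)] with z hz hd x
  have hsrc := (ch w).map_target hz.1
  have hd' : MDifferentiableAt (𝓘(ℝ, E).tangent) 𝓘(ℝ, ℝ) (sqLength L ζ) ((ch w).symm z) := by
    refine (mdifferentiableAt_iff_coord hsrc).2 ?_
    rw [(ch w).right_inv hz.1]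
    exact hd.differentiableAt two_ne_zero
  have hx : dch w ((ch w).symm z) (constV w x ((ch w).symm z)) = x := coordV_constV x hz.1
  have h1 := dFun_eq hsrc hd' (constV w x ((ch w).symm z))
  rw [hζ.dFun_sqLength hL hz.2, metric_eq hL hz.2 hsrc, dbase_rho hsrc, hx,
    (ch w).right_inv hz.1] at h1
  exact h1.symm

theorem IsConcurrent.fderiv_sqLength_vertical (hζ : IsConcurrent L ζ) (hL : IsFinsler L)
    (hw : w ∈ slit E M) : ∀ᶠ z in 𝓝 (ch w w), ∀ c : E,
      fderiv ℝ (coordF w (sqLength L ζ)) z (0, c) = 0 := by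
  filter_upwards [hζ.fderiv_sqLength hL hw] with z hz c
  rw [hz, Prod.mk_zero_zero, map_zero]
  simp

theorem IsConcurrent.hess_sqLength_vertical (hζ : IsConcurrent L ζ) (hL : IsFinsler L)
    (hw : w ∈ slit E M) : ∀ᶠ z in 𝓝 (ch w w), ∀ (x : E × E) (c : E),
      hess (coordF w (sqLength L ζ)) z x (0, c) = 0 := by
  filter_upwards [eventually_contDiffAt_two (hζ.contDiffAt_sqLength hL hw),
    eventually_eventually_nhds.2 (hζ.fderiv_sqLength_vertical hL hw)] with z hz h0 x c
  have h1 := fderiv_fderiv_apply_of_two hz (differentiableAt_const ((0 : E), c)) x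
  have h2 : (fun y => fderiv ℝ (coordF w (sqLength L ζ)) y (0, c)) =ᶠ[𝓝 z] fun _ => 0 := by
    filter_upwards [h0] with y hy using hy c
  rw [h2.fderiv_eq] at h1
  simpa using h1.symm

/-- In coordinates, the components of a concurrent field do not depend on the direction. -/
theorem IsConcurrent.fderiv_coordP_vertical [FiniteDimensional ℝ E] (hζ : IsConcurrent L ζ)
    (hL : IsFinsler L) (hw : w ∈ slit E M) (c : E) :
    fderiv ℝ (coordP w ζ) (ch w w) (0, c) = 0 := by
  obtain ⟨D, hD, hDζ⟩ := hζ.2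
  have hq := hL.contDiffAt_self hw
  have hP := hζ.contDiffAt_sqLength hL hw
  have hζ0 := hζ.diffAt hw
  have h1 : fderiv ℝ (coordP w ζ) (ch w w) (0, c) + D.chr w (ζ w) (0, c) = 0 := by
    have h2 := D.D_eq hw hζ0 (0, c)
    have h3 : D.D ζ w ((0, c) : E × E) = (0 : E) :=
      (congrArg (fun A : TTan w →L[ℝ] PiFib w => A ((0, c) : E × E)) (hDζ w hw)).trans
        ((congrArg (fun y : E => -y) (rho_self w (0, c))).trans neg_zero)
    exact h2.symm.trans h3
  refine vmetric_ext hL hw fun a => ?_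
  -- Differentiate dP(a, 0) = -2 g(a, ζ) along `(0, c)`. The left side vanishes, so the third
  -- derivative on (c, a, ζ) plus g(∂_c ζ, a) is zero. Since `D ζ` kills vertical vectors, the
  -- vertical symbol of ζ is -∂_c ζ, and the Cartan tensor formula makes that third derivative -2
  -- g(∂_c ζ, a). Together these force g(∂_c ζ, a) = 0.
  have h4 : (fun z => fderiv ℝ (coordF w (sqLength L ζ)) z (a, 0)) =ᶠ[𝓝 (ch w w)]
      fun z => -2 * hess (coordE w L) z (0, a) (0, coordP w ζ z) := by
    filter_upwards [hζ.fderiv_sqLength hL hw] with z hz using hz _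
  have hd := hasFDerivAt_zero_coordP hζ0
  have h5 := fderiv_fderiv_apply hP (differentiableAt_const (a, (0 : E))) ((0 : E), c)
  have h6 := fderiv_hess_apply hq (differentiableAt_const ((0 : E), a)) hd.differentiableAt (0, c)
  have hdiff : DifferentiableAt ℝ
      (fun z => hess (coordE w L) z (0, a) (0, coordP w ζ z)) (ch w w) :=
    ((differentiableAt_of_contDiffAt (contDiffAt_fderiv (contDiffAt_fderiv hq))).clm_apply
      (differentiableAt_const _)).clm_apply hd.differentiableAt
  rw [hess_comm (hP.of_le two_le_infty),
    (hζ.hess_sqLength_vertical hL hw).self_of_nhds, h4.fderiv_eq,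
    fderiv_const_mul hdiff] at h5
  rw [hd.fderiv, coordP_self] at h6
  have h7 := hD.vmetric_chr_vertical hL hw (ζ w) a c
  rw [third_comm_right hq] at h7
  have h8 : D.chr w (ζ w) (0, c) = -fderiv ℝ (coordP w ζ) (ch w w) (0, c) :=
    (neg_eq_of_add_eq_zero_right h1).symm
  simp only [fderiv_fun_const, Pi.zero_apply, zero_apply, map_zero, add_zero, smul_apply,
    smul_eq_mul] at h5 h6
  have h9 : hess (coordE w L) (ch w w) (0, a) ((((0 : E × E →L[ℝ] E).prod
      (fderiv ℝ (coordP w ζ) (ch w w)))) (0, c)) =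
      vmetric L w (fderiv ℝ (coordP w ζ) (ch w w) (0, c)) a :=
    vmetric_comm hL hw a _
  rw [h9] at h6
  rw [h8, map_neg, neg_apply] at h7
  rw [map_zero, zero_apply]
  linarith

/-! ### Derivatives of B = g(ζ, η), obtained from those of p² -/

theorem IsConcurrent.pairing_eq (hζ : IsConcurrent L ζ) (hL : IsFinsler L) (hw : w ∈ slit E M) :
    coordF w (pairing L ζ) =ᶠ[𝓝 (ch w w)]
      fun z => -(1 / 2) * fderiv ℝ (coordF w (sqLength L ζ)) z (z.2, 0) := by
  filter_upwards [coordF_metric_eventuallyEq hL hw ζ eta, eventually_target_slit hw,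
    coordP_eta_eventuallyEq w, hζ.fderiv_sqLength hL hw] with z h1 h2 h3 h4
  rw [h4]
  refine h1.trans ?_
  rw [h3, hess_comm ((hL.contDiffAt_coordE_of_target h2.1 h2.2).of_le two_le_infty)]
  ring

theorem hasFDerivAt_snd_zero (z : E × E) : HasFDerivAt (fun y : E × E => (y.2, (0 : E)))
    ((ContinuousLinearMap.snd ℝ E E).prod (0 : E × E →L[ℝ] E)) z :=
  hasFDerivAt_snd.prodMk (hasFDerivAt_const _ _)

theorem IsConcurrent.contDiffAt_pairing (hζ : IsConcurrent L ζ) (hL : IsFinsler L)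
    (hw : w ∈ slit E M) : ContDiffAt ℝ ∞ (coordF w (pairing L ζ)) (ch w w) := by
  refine ContDiffAt.congr_of_eventuallyEq ?_ (hζ.pairing_eq hL hw)
  exact contDiffAt_const.mul ((contDiffAt_fderiv (hζ.contDiffAt_sqLength hL hw)).clm_apply
    (contDiffAt_snd.prodMk contDiffAt_const))

theorem IsConcurrent.fderiv_pairing (hζ : IsConcurrent L ζ) (hL : IsFinsler L)
    (hw : w ∈ slit E M) : ∀ᶠ z in 𝓝 (ch w w), ∀ x : E × E,
      fderiv ℝ (coordF w (pairing L ζ)) z x =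
        -(1 / 2) * (hess (coordF w (sqLength L ζ)) z x (z.2, 0) +
          fderiv ℝ (coordF w (sqLength L ζ)) z (x.2, 0)) := by
  filter_upwards [eventually_contDiffAt_two (hζ.contDiffAt_sqLength hL hw),
    eventually_eventually_nhds.2 (hζ.pairing_eq hL hw)] with z hz h0 x
  have hd : DifferentiableAt ℝ (fderiv ℝ (coordF w (sqLength L ζ))) z :=
    (hz.fderiv_right (m := 1) (by norm_num)).differentiableAt one_ne_zero
  have h2 : coordF w (pairing L ζ) =ᶠ[𝓝 z]
      fun z => -(1 / 2) * fderiv ℝ (coordF w (sqLength L ζ)) z (z.2, 0) := h0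
  rw [h2.fderiv_eq, fderiv_const_mul
    (hd.clm_apply (hasFDerivAt_snd_zero z).differentiableAt), smul_apply,
    fderiv_fderiv_apply_of_two hz (hasFDerivAt_snd_zero z).differentiableAt,
    (hasFDerivAt_snd_zero z).fderiv]
  rfl

theorem IsConcurrent.fderiv_pairing_vertical (hζ : IsConcurrent L ζ) (hL : IsFinsler L)
    (hw : w ∈ slit E M) : ∀ᶠ z in 𝓝 (ch w w), ∀ c : E,
      fderiv ℝ (coordF w (pairing L ζ)) z (0, c) =
        -(1 / 2) * fderiv ℝ (coordF w (sqLength L ζ)) z (c, 0) := by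
  filter_upwards [hζ.fderiv_pairing hL hw, hζ.hess_sqLength_vertical hL hw,
    eventually_contDiffAt_two (hζ.contDiffAt_sqLength hL hw)] with z h1 h2 h3 c
  rw [h1, hess_comm h3, h2, zero_add]

theorem IsConcurrent.fderiv_pairing_vertical_self (hζ : IsConcurrent L ζ) (hL : IsFinsler L)
    (hw : w ∈ slit E M) (c : E) :
    fderiv ℝ (coordF w (pairing L ζ)) (ch w w) (0, c) = vmetric L w (ζ w) c := by
  rw [(hζ.fderiv_pairing_vertical hL hw).self_of_nhds,
    (hζ.fderiv_sqLength hL hw).self_of_nhds, coordP_self]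
  have h : ∀ z : E, -(1 / 2) * (-2 * vmetric L w c z) = vmetric L w z c := fun z => by
    rw [vmetric_comm hL hw c]
    ring
  exact h (ζ w)

theorem IsConcurrent.fderiv_pairing_horizontal_self (hζ : IsConcurrent L ζ) (hL : IsFinsler L)
    (hw : w ∈ slit E M) (c : E) :
    fderiv ℝ (coordF w (pairing L ζ)) (ch w w) (c, 0) =
      -(1 / 2) * hess (coordF w (sqLength L ζ)) (ch w w) (c, 0) ((ch w w).2, 0) := by
  rw [(hζ.fderiv_pairing hL hw).self_of_nhds, Prod.mk_zero_zero, map_zero, add_zero]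

theorem IsConcurrent.hess_pairing_self (hζ : IsConcurrent L ζ) (hL : IsFinsler L)
    (hw : w ∈ slit E M) (x : E × E) (c : E) :
    hess (coordF w (pairing L ζ)) (ch w w) x (0, c) =
      -(1 / 2) * hess (coordF w (sqLength L ζ)) (ch w w) x (c, 0) := by
  have hP := hζ.contDiffAt_sqLength hL hw
  have h1 := fderiv_fderiv_apply (hζ.contDiffAt_pairing hL hw)
    (differentiableAt_const ((0 : E), c)) x
  have h2 := fderiv_fderiv_apply hP (differentiableAt_const (c, (0 : E))) x
  have h3 : (fun z => fderiv ℝ (coordF w (pairing L ζ)) z (0, c)) =ᶠ[𝓝 (ch w w)]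
      fun z => -(1 / 2) * fderiv ℝ (coordF w (sqLength L ζ)) z (c, 0) := by
    filter_upwards [hζ.fderiv_pairing_vertical hL hw] with z hz using hz c
  rw [h3.fderiv_eq, fderiv_const_mul ((differentiableAt_of_contDiffAt
    (contDiffAt_fderiv hP)).clm_apply (differentiableAt_const _)), smul_apply, h2] at h1
  simpa using h1.symm

/-- By metricity dB(G) = g(∇_G ζ, η) + g(ζ, ∇_G η). The first term is -g(η, η) by concurrence, and
the second vanishes because the spray is horizontal. -/
theorem IsConcurrent.fderiv_pairing_spray [FiniteDimensional ℝ E] (hζ : IsConcurrent L ζ)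
    (hL : IsFinsler L) (hw : w ∈ slit E M) {G : VField E M} (hG : IsCanonicalSpray L G) :
    fderiv ℝ (coordF w (pairing L ζ)) (ch w w) (G w) = -(2 * energy L w) := by
  obtain ⟨D, hD, hDζ⟩ := hζ.2
  have h := hD.fderiv_metric hL hw (hζ.diffAt hw) (diffAt_eta w) (G w)
  have h1 : D.D ζ w (G w) = (-(ch w w).2 : E) := by
    have h2 : D.D ζ w (G w) = (-(rho w (G w) : E) : E) :=
      congrArg (fun A : TTan w →L[ℝ] PiFib w => A (G w)) (hDζ w hw)
    have h3 : (rho w (G w) : E) = (ch w w).2 := (rho_self w (G w)).trans (hG.fst_eq hL hw)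
    exact h2.trans (congrArg (fun y : E => -y) h3)
  have h4 : D.D eta w (G w) = (0 : E) := hG.K_eq_zero hD hL hw
  have heta : (eta w : E) = (ch w w).2 := (ch_self_snd w).symm
  refine h.trans ?_
  rw [h1, h4, heta, map_zero, add_zero, map_neg, neg_apply, vmetric_eta_eta hL hw]

end Concurrent

/-! ### The energy change -/

section Change

variable {L L' : TM E M → ℝ} {ζ : PiField E M} {w : TM E M}

theorem IsEnergyChange.coordE_eq (h : IsEnergyChange L L' ζ) (hw : w ∈ slit E M) :
    coordE w L' =ᶠ[𝓝 (ch w w)]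
      fun z => coordE w L z + coordF w (pairing L ζ) z ^ 2 / 2 := by
  filter_upwards [eventually_slit hw] with z hz
  have := h _ hz
  unfold coordE coordF energy pairing
  rw [this]
  ring

theorem IsEnergyChange.fderiv_coordE (h : IsEnergyChange L L' ζ) (hζ : IsConcurrent L ζ)
    (hL : IsFinsler L) (hw : w ∈ slit E M) : ∀ᶠ z in 𝓝 (ch w w), ∀ x : E × E,
      fderiv ℝ (coordE w L') z x = fderiv ℝ (coordE w L) z x +
        coordF w (pairing L ζ) z * fderiv ℝ (coordF w (pairing L ζ)) z x := by
  filter_upwards [eventually_contDiffAt_two (hL.contDiffAt_self hw),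
    eventually_contDiffAt_two (hζ.contDiffAt_pairing hL hw),
    eventually_eventually_nhds.2 (h.coordE_eq hw)] with z h1 h2 h3 x
  have h3' : coordE w L' =ᶠ[𝓝 z]
      fun z => coordE w L z + coordF w (pairing L ζ) z ^ 2 / 2 := h3
  have h4 := (h1.differentiableAt two_ne_zero).hasFDerivAt.add
    (((h2.differentiableAt two_ne_zero).hasFDerivAt.pow 2).mul_const (1 / 2 : ℝ))
  have h5 : coordE w L' =ᶠ[𝓝 z] coordE w L + fun z =>
      coordF w (pairing L ζ) z ^ 2 * (1 / 2 : ℝ) := by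
    refine h3'.trans (Filter.Eventually.of_forall fun y => ?_)
    simp
    ring
  rw [h5.fderiv_eq, h4.fderiv]
  simp
  ring

theorem IsEnergyChange.hess_coordE (h : IsEnergyChange L L' ζ) (hζ : IsConcurrent L ζ)
    (hL : IsFinsler L) (hL' : IsFinsler L') (hw : w ∈ slit E M) (x y : E × E) :
    hess (coordE w L') (ch w w) x y = hess (coordE w L) (ch w w) x y +
      fderiv ℝ (coordF w (pairing L ζ)) (ch w w) x *
        fderiv ℝ (coordF w (pairing L ζ)) (ch w w) y +
      coordF w (pairing L ζ) (ch w w) * hess (coordF w (pairing L ζ)) (ch w w) x y := by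
  have hB := hζ.contDiffAt_pairing hL hw
  have hq := hL.contDiffAt_self hw
  have hy := differentiableAt_const (𝕜 := ℝ) (x := ch w w) y
  have h1 := fderiv_fderiv_apply (hL'.contDiffAt_self hw) hy x
  have h2 := fderiv_fderiv_apply hq hy x
  have h3 := fderiv_fderiv_apply hB hy x
  have h4 : (fun z => fderiv ℝ (coordE w L') z y) =ᶠ[𝓝 (ch w w)]
      fun z => fderiv ℝ (coordE w L) z y +
        coordF w (pairing L ζ) z * fderiv ℝ (coordF w (pairing L ζ)) z y := by
    filter_upwards [h.fderiv_coordE hζ hL hw] with z hz using hz y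
  have hd1 := (differentiableAt_of_contDiffAt (contDiffAt_fderiv hq)).clm_apply hy
  have hd2 := (differentiableAt_of_contDiffAt (contDiffAt_fderiv hB)).clm_apply hy
  have hdB := differentiableAt_of_contDiffAt hB
  rw [h4.fderiv_eq, fderiv_fun_add hd1 (hdB.fun_mul hd2), fderiv_fun_mul hdB hd2] at h1
  simp only [fderiv_fun_const, Pi.zero_apply, zero_apply, map_zero, add_zero, add_apply,
    smul_apply, smul_eq_mul] at h1 h2 h3
  rw [h2, h3] at h1
  linarith

theorem sqLength_nonneg (hL : IsFinsler L) (hw : w ∈ slit E M) : 0 ≤ sqLength L ζ w := by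
  exact (vmetric_self_nonneg hL hw _).trans_eq (metric_self hL hw _ _).symm

/-- The canonical sprays of `L` and of its energy change. -/
theorem IsEnergyChange.spray_eq [FiniteDimensional ℝ E] (h : IsEnergyChange L L' ζ)
    (hζ : IsConcurrent L ζ) (hL : IsFinsler L) (hL' : IsFinsler L') {G G' : VField E M}
    (hG : IsCanonicalSpray L G) (hG' : IsCanonicalSpray L' G') (hw : w ∈ slit E M) :
    G' w = G w + (2 * energy L w / (1 + sqLength L ζ w)) • gam w (ζ w) := by
  have hG1 := hG.fst_eq hL hw
  have hG1' := hG'.fst_eq hL' hw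
  set g : E × E := G w with hg
  set g' : E × E := G' w with hg'
  set B := coordF w (pairing L ζ)
  set P := coordF w (sqLength L ζ)
  set ζ₀ : E := ζ w
  set k := fderiv ℝ B (ch w w) g'
  have hP2 := (hζ.contDiffAt_sqLength hL hw).of_le two_le_infty
  have hPv := (hζ.hess_sqLength_vertical hL hw).self_of_nhds
  have hdec : g' = g + (0, g'.2 - g.2) := Prod.ext (by simp [hG1, hG1']) (by simp)
  -- Subtract the spray equations of `L'` and `L`, both tested on `(0, c)`; the term that survives
  -- is dB(g') dB(0, c) = k g(ζ, c).
  have hμ : g'.2 - g.2 = -k • ζ₀ := by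
    refine vmetric_ext hL hw fun c => ?_
    have h1 : hess (coordE w L') (ch w w) g' (0, c) = _ := hG'.hess_vertical hL' hw c
    rw [h.hess_coordE hζ hL hL' hw, (h.fderiv_coordE hζ hL hw).self_of_nhds,
      hζ.hess_pairing_self hL hw, hζ.fderiv_pairing_horizontal_self hL hw,
      hζ.fderiv_pairing_vertical_self hL hw] at h1
    -- Hess P ignores the vertical part of `g'`, whose base part is y. Hence B Hess B(g', (0, c))
    -- equals B dB(c, 0), which is exactly the extra term on the other side.
    have h2 : hess P (ch w w) g' (c, 0) = hess P (ch w w) (c, 0) ((ch w w).2, 0) := by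
      have h3 : g' = ((ch w w).2, 0) + (0, g'.2) := Prod.ext (by simp [hG1']) (by simp)
      rw [hess_comm hP2, h3, map_add, hPv, add_zero]
    have h4 : hess (coordE w L) (ch w w) g' (0, c) =
        hess (coordE w L) (ch w w) g (0, c) + vmetric L w (g'.2 - g.2) c := by
      rw [vmetric_apply, ← add_apply, ← map_add, ← hdec]
    have h5 := hG.hess_vertical hL hw c
    rw [map_smul, smul_apply, smul_eq_mul]
    change hess (coordE w L) (ch w w) g' (0, c) + k * vmetric L w ζ₀ c +
      B (ch w w) * (-(1 / 2) * hess P (ch w w) g' (c, 0)) = _ at h1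
    rw [h2, h4] at h1
    change hess (coordE w L) (ch w w) g (0, c) = _ at h5
    linarith
  have hp : sqLength L ζ w = vmetric L w ζ₀ ζ₀ := metric_self hL hw _ _
  -- The constant `k` was defined through the unknown `g'`; applying dB to the formula for `g'`
  -- gives k = dB(g) - k p², which determines it.
  have hk : k * (1 + sqLength L ζ w) = -(2 * energy L w) := by
    have h1 : k = fderiv ℝ B (ch w w) g + fderiv ℝ B (ch w w) (0, g'.2 - g.2) := by
      rw [← map_add, ← hdec]
    rw [hζ.fderiv_pairing_vertical_self hL hw, hμ, map_smul, smul_eq_mul,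
      show fderiv ℝ B (ch w w) g = _ from hζ.fderiv_pairing_spray hL hw hG] at h1
    rw [hp]
    linarith
  have hpos : 1 + sqLength L ζ w ≠ 0 := by
    have := sqLength_nonneg (ζ := ζ) hL hw
    positivity
  have hk' : 2 * energy L w / (1 + sqLength L ζ w) = -k := by
    rw [div_eq_iff hpos]
    linarith
  rw [hk']
  have hgam : gam w (ζ w) = ((0, ζ₀) : E × E) := gam_self w ζ₀
  rw [hgam]
  change g' = g + -k • ((0, ζ₀) : E × E)
  rw [hdec, hμ]
  simp

/-! ### The Barthel connection -/

/-- If X has constant coordinates then so has JX, so both brackets reduce to directional derivatives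
of the components of `G`. -/
theorem barthel_self (G : VField E M) (w : TM E M) (x : E × E) :
    (bracket (JField (constV w x)) G w - J w (bracket (constV w x) G w) : E × E) =
      fderiv ℝ (coordV w G) (ch w w) (0, x.1) - (0, (fderiv ℝ (coordV w G) (ch w w) x).1) := by
  have h1 : coordV w (JField (constV w x)) =ᶠ[𝓝 (ch w w)] fun _ => ((0 : E), x.1) := by
    filter_upwards [eventually_target (mem_ch_source_self w)] with z hz
    rw [coordV_JField _ hz, coordV_constV x hz]
  have h2 : bracket (JField (constV w x)) G w = fderiv ℝ (coordV w G) (ch w w) (0, x.1) := by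
    rw [bracket_self, h1.lieBracket_vectorField_eq (Filter.EventuallyEq.refl _ _)]
    simp [lieBracket]
    rfl
  have h3 : bracket (constV w x) G w = fderiv ℝ (coordV w G) (ch w w) x := by
    rw [bracket_self, (coordV_constV_eventuallyEq w x).lieBracket_vectorField_eq
      (Filter.EventuallyEq.refl _ _)]
    simp [lieBracket]
    rfl
  have h4 : ∀ y : E × E, J w y = ((0, y.1) : E × E) := fun y =>
    (gam_self w (rho w y)).trans (congrArg (fun a : E => ((0, a) : E × E)) (rho_self w y))
  rw [h2, h3]
  exact congrArg (fun y : E × E => fderiv ℝ (coordV w G) (ch w w) (0, x.1) - y) (h4 _)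

/-- The pointwise comparison of sprays, applied at every nearby point and read in a single chart, so
that it can be differentiated. -/
theorem IsEnergyChange.coordV_spray [FiniteDimensional ℝ E] (h : IsEnergyChange L L' ζ)
    (hζ : IsConcurrent L ζ) (hL : IsFinsler L) (hL' : IsFinsler L') {G G' : VField E M}
    (hG : IsCanonicalSpray L G) (hG' : IsCanonicalSpray L' G') (hw : w ∈ slit E M) :
    coordV w G' =ᶠ[𝓝 (ch w w)] fun z => coordV w G z +
      (0, (2 * coordE w L z / (1 + coordF w (sqLength L ζ) z)) • coordP w ζ z) := by
  filter_upwards [eventually_target_slit hw] with z hz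
  have h1 := h.spray_eq hζ hL hL' hG hG' hz.2
  have h2 := dch_gam ((ch w).map_target hz.1) (ζ ((ch w).symm z))
  unfold coordV coordE coordF
  rw [h1, map_add, map_smul, h2]
  refine congrArg (fun y : E × E => dch w ((ch w).symm z) (G ((ch w).symm z)) + y) ?_
  exact Prod.ext (smul_zero _) rfl

theorem IsEnergyChange.barthel_apply [FiniteDimensional ℝ E] (h : IsEnergyChange L L' ζ)
    (hζ : IsConcurrent L ζ) (hL : IsFinsler L) (hL' : IsFinsler L')
    {Γ Γ' : ∀ w : TM E M, TTan w →L[ℝ] TTan w} (hΓ : IsBarthel L Γ) (hΓ' : IsBarthel L' Γ')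
    (hw : w ∈ slit E M) (x : TTan w) :
    Γ' w x = Γ w x + (2 * (1 / (1 + sqLength L ζ w) * dJ (energy L) w x)) • gam w (ζ w) := by
  obtain ⟨G, hG, hΓG⟩ := hΓ
  obtain ⟨G', hG', hΓG'⟩ := hΓ'
  have hx : constV w x w = x := constV_self w x
  have e1 := hΓG w hw (constV w x) (diffAt_constV w x)
  have e2 := hΓG' w hw (constV w x) (diffAt_constV w x)
  rw [hx] at e1 e2
  have e1' := e1.trans (barthel_self G w x)
  have e2' := e2.trans (barthel_self G' w x)
  have hp0 := sqLength_nonneg (ζ := ζ) hL hw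
  have hPw : coordF w (sqLength L ζ) (ch w w) = sqLength L ζ w := by
    unfold coordF
    rw [(ch w).left_inv (mem_ch_source_self w)]
  have hpos : 1 + coordF w (sqLength L ζ) (ch w w) ≠ 0 := by
    rw [hPw]
    positivity
  have hGd := (differentiableAt_of_contDiffAt (hG.smooth.contDiffAt_coordV hw)).hasFDerivAt
  have hζd := (differentiableAt_of_contDiffAt (hζ.contDiffAt_coordP hw)).hasFDerivAt
  have hPd := differentiableAt_of_contDiffAt (hζ.contDiffAt_sqLength hL hw)
  have hqd := differentiableAt_of_contDiffAt (hL.contDiffAt_self hw)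
  have hPv := (hζ.fderiv_sqLength_vertical hL hw).self_of_nhds
  set f : E × E → ℝ := fun z => 2 * coordE w L z / (1 + coordF w (sqLength L ζ) z)
  have hfd : DifferentiableAt ℝ f (ch w w) :=
    ((hqd.const_mul 2).fun_mul ((hPd.const_add 1).inv hpos)).congr_of_eventuallyEq
      (Filter.Eventually.of_forall fun z => div_eq_mul_inv _ _)
  -- The product f(1 + p²) = 2E is differentiated in place of the quotient; p² contributes nothing
  -- along the fibre.
  have hfv : ∀ a : E, fderiv ℝ f (ch w w) (0, a) =
      2 * fderiv ℝ (coordE w L) (ch w w) (0, a) / (1 + sqLength L ζ w) := fun a => by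
    have h1 : fderiv ℝ (fun z => f z * (1 + coordF w (sqLength L ζ) z)) (ch w w) (0, a) =
        2 * fderiv ℝ (coordE w L) (ch w w) (0, a) := by
      have h2 : (fun z => f z * (1 + coordF w (sqLength L ζ) z)) =ᶠ[𝓝 (ch w w)]
          fun z => 2 * coordE w L z := by
        filter_upwards [(hPd.const_add 1).continuousAt.eventually_ne hpos] with z hz
        exact div_mul_cancel₀ _ hz
      rw [h2.fderiv_eq, fderiv_const_mul hqd]
      rfl
    rw [fderiv_fun_mul hfd (hPd.const_add 1), fderiv_const_add] at h1
    rw [eq_div_iff (by rwa [← hPw]), ← h1, hPw]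
    simp [hPv]
    ring
  have hD := hGd.add ((hasFDerivAt_const (0 : E) (ch w w)).prodMk
    (hfd.hasFDerivAt.smul hζd))
  have hD' := (hD.congr_of_eventuallyEq (h.coordV_spray hζ hL hL' hG hG' hw)).fderiv
  have hJ : dJ (energy L) w x = fderiv ℝ (coordE w L) (ch w w) (0, (x : E × E).1) :=
    dJ_self hL hw x
  have hgam : gam w (ζ w) = ((0, (ζ w : E)) : E × E) := gam_self w (ζ w)
  have hζv := hζ.fderiv_coordP_vertical hL hw
  have hζw : coordP w ζ (ch w w) = ζ w := coordP_self w ζ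
  set x' : E × E := x
  have hs : 2 * (1 / (1 + sqLength L ζ w) * fderiv ℝ (coordE w L) (ch w w) (0, x'.1)) =
      fderiv ℝ f (ch w w) (0, x'.1) := by
    rw [hfv]
    ring
  -- The sprays differ by a field without base component, so the second term is unchanged. In the
  -- first, the fibre derivative of fζ is df ⊗ ζ, because the components of ζ are constant along the
  -- fibre.
  have key : ∀ ζ₀ : E, coordP w ζ (ch w w) = ζ₀ →
      (fderiv ℝ (coordV w G') (ch w w) (0, x'.1) -
        (0, (fderiv ℝ (coordV w G') (ch w w) x').1) : E × E) =
      (fderiv ℝ (coordV w G) (ch w w) (0, x'.1) -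
        (0, (fderiv ℝ (coordV w G) (ch w w) x').1) : E × E) +
      fderiv ℝ f (ch w w) (0, x'.1) • ((0, ζ₀) : E × E) := fun ζ₀ h0 => by
    rw [hD', h0]
    refine Prod.ext ?_ ?_
    · simp
    · simp [hζv]
      abel
  rw [hgam, hJ, hs, e1']
  exact e2'.trans (key _ hζw)

end Change

end Finsler

end

open Finsler in
theorem theorem2 {E : Type*} [NormedAddCommGroup E] [NormedSpace ℝ E] [FiniteDimensional ℝ E]
    {M : Type*} [TopologicalSpace M] [ChartedSpace E M] [IsManifold 𝓘(ℝ, E) ∞ M]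
    [T2Space M] [ParacompactSpace M]
    (L L' : TM E M → ℝ) (hL : IsFinsler L) (hL' : IsFinsler L')
    (ζ : PiField E M) (hζ : IsConcurrent L ζ) (hLL' : IsEnergyChange L L' ζ)
    (Γ Γ' : ∀ w : TM E M, TTan w →L[ℝ] TTan w) (hΓ : IsBarthel L Γ) (hΓ' : IsBarthel L' Γ') :
    ∀ w ∈ slit E M,
      Γ' w = Γ w + (2 : ℝ) • ((1 / (1 + metric L w (ζ w) (ζ w))) • dJ (energy L) w).smulRight
        (gam w (ζ w)) ∧
      hProj Γ' w = hProj Γ w - changeForm L ζ w ∧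
      vProj Γ' w = vProj Γ w + changeForm L ζ w := by
  intro w hw
  have h : Γ' w = Γ w + (2 : ℝ) •
      ((1 / (1 + metric L w (ζ w) (ζ w))) • dJ (energy L) w).smulRight (gam w (ζ w)) := by
    ext x
    refine (hLL'.barthel_apply hζ hL hL' hΓ hΓ' hw x).trans ?_
    simp only [add_apply, smul_apply, ContinuousLinearMap.smulRight_apply, smul_eq_mul, smul_smul]
    rfl
  refine ⟨h, ?_, ?_⟩
  · unfold hProj changeForm
    rw [h]
    module
  · unfold vProj changeForm
    rw [h]
    module
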